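/- Let $(\Omega,\mathcal F,\mathbb P)$ be a probability space, and let $(X_k)_{k\in\mathbb Z}$ be a stationary sequence of real random variables with $\mathbb E(X_0)=0$ and $\mathbb E(X_0^2)<\infty$, and $(\mathcal F_k)_{k\in\mathbb Z}$ a filtration, given in either of the following two ways. (a) $T:\Omega\to\Omega$ is a bijective bi-measurable transformation preserving $\mathbb P$, $\mathcal F_0\subseteq\mathcal F$ is a $\sigma$-algebra with $\mathcal F_0\subseteq T^{-1}(\mathcal F_0)$, $X_0$ is $\mathcal F_0$-measurable, and $X_k=X_0\circ T^k$, $\mathcal F_k=T^{-k}(\mathcal F_0)$ for $k\in\mathbb Z$. (b) $(\xi_k)_{k\in\mathbb Z}$ is a stationary Markov chain on $(\Omega,\mathcal F,\mathbb P)$ with values in a measurable space and marginal law $\pi$, $f$ is a measurable function with $\int f^2\,d\pi<\infty$ and $\int f\,d\pi=0$, and $X_k=f(\xi_k)$, $\mathcal F_k=\sigma(\xi_i,\ i\le k)$ for $k\in\mathbb Z$. Put $S_n=\sum_{i=0}^{n-1}X_i$, $\mathbb E_0(\cdot)=\mathbb E(\cdot\mid\mathcal F_0)$, let $\|\cdot\|$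 be the norm of $L^2(\Omega,\mathcal F,\mathbb P)$, and $\log_2 n=\log(\log(\max(e,n)))$. Assume that $$\sum_{n\ge1}\frac{\log n}{n}\Big(\sum_{k\ge n}\frac{\|\mathbb E_0(S_k)\|}{k^{3/2}}\Big)^2<\infty .$$ Then there is a stationary sequence $(D_k)_{k\in\mathbb Z}$ of square integrable random variables such that $D_k$ is $\mathcal F_{k+1}$-measurable and $\mathbb E(D_k\mid\mathcal F_k)=0$ a.s. for every $k\in\mathbb Z$ (so that $M_n=\sum_{i=0}^{n-1}D_i$ is a martingale with respect to $(\mathcal F_n)_{n\ge0}$ with stationary and square integrable differences), and $$\frac{S_n-M_n}{(n\log_2 n)^{1/2}}\longrightarrow 0\quad\text{a.s. as } n\to\infty .$$ In case (a) one can take $D_k=D_0\circ T^k$ for every $k\in\mathbb Z$. -/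

import Mathlib

open MeasureTheory ProbabilityTheory Filter Topology

namespace MartApprox

/-- The iterate `T ^ k`, `k ∈ ℤ`, of a bijective bi-measurable map `T`. -/
def iter {Ω : Type*} {_ : MeasurableSpace Ω} (T : Ω ≃ᵐ Ω) (k : ℤ) : Ω → Ω :=
  ((T.toEquiv : Equiv.Perm Ω) ^ k : Equiv.Perm Ω)

theorem iter_succ {Ω : Type*} {_ : MeasurableSpace Ω} (T : Ω ≃ᵐ Ω) (k : ℤ) :
    iter T (k + 1) = T ∘ iter T k := by
  funext ω
  simp only [iter, add_comm k 1, zpow_add, zpow_one, Equiv.Perm.mul_apply, Function.comp_apply]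
  rfl

theorem measurable_iter {Ω : Type*} {_ : MeasurableSpace Ω} (T : Ω ≃ᵐ Ω) (k : ℤ) :
    Measurable (iter T k) := by
  induction k using Int.induction_on with
  | zero => simpa [iter] using measurable_id
  | succ n ih => rw [iter_succ]; exact T.measurable.comp ih
  | pred n ih =>
    have h : iter T (-(n : ℤ) - 1) = T.symm ∘ iter T (-(n : ℤ)) := by
      have h' := iter_succ T (-(n : ℤ) - 1)
      rw [sub_add_cancel] at h'
      rw [h']
      funext ω
      simp
    rw [h]
    exact T.symm.measurable.comp ih

/-- The filtration `ℱ_k = T ^ {-k}(ℱ₀)`, where `ℱ₀ ⊆ T⁻¹(ℱ₀)`. Here `F₀.comap g` is the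
σ-algebra of all `g⁻¹(A)` with `A ∈ F₀`. -/
def shiftFiltration {Ω : Type*} {mΩ : MeasurableSpace Ω} (T : Ω ≃ᵐ Ω) (F₀ : MeasurableSpace Ω)
    (hF₀ : F₀ ≤ mΩ) (hT : F₀ ≤ F₀.comap T) : Filtration ℤ mΩ where
  seq k := F₀.comap (iter T k)
  mono' := by
    refine monotone_int_of_le_succ fun k => ?_
    rw [iter_succ, ← MeasurableSpace.comap_comp]
    exact MeasurableSpace.comap_mono hT
  le' k := (MeasurableSpace.comap_mono hF₀).trans (measurable_iter T k).comap_le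

/-- The filtration of the past of a process: `ℱ_k` is generated by the `ξ i` with `i ≤ k`. -/
def pastFiltration {Ω S : Type*} [mΩ : MeasurableSpace Ω] [mS : MeasurableSpace S]
    (ξ : ℤ → Ω → S) (hξ : ∀ k, Measurable (ξ k)) : Filtration ℤ mΩ where
  seq k := ⨆ i : Set.Iic k, mS.comap (ξ i)
  mono' _ l hkl := iSup_le fun i =>
    le_iSup (fun j : Set.Iic l => mS.comap (ξ j)) ⟨i.1, le_trans i.2 hkl⟩
  le' _ := iSup_le fun i => (hξ i).comap_le

/-- The restriction of a filtration indexed by `ℤ` to the nonnegative times. -/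
def natRestrict {Ω : Type*} {mΩ : MeasurableSpace Ω} (ℱ : Filtration ℤ mΩ) :
    Filtration ℕ mΩ where
  seq n := ℱ (n : ℤ)
  mono' _ _ h := ℱ.mono (Int.ofNat_le.mpr h)
  le' n := ℱ.le n

/-- (Strict) stationarity: the law of the whole sequence is invariant under time shifts. -/
def IsStationary {Ω E : Type*} [MeasurableSpace Ω] [MeasurableSpace E]
    (Y : ℤ → Ω → E) (μ : Measure Ω) : Prop :=
  ∀ m : ℤ, IdentDistrib (fun ω k => Y (k + m) ω) (fun ω k => Y k ω) μ μ

/-- A stationary Markov chain `(ξ_k)_{k ∈ ℤ}`: for every measurable `A`,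
`P(ξ_{k+1} ∈ A | ξ_i, i ≤ k) = P(ξ_{k+1} ∈ A | ξ_k)` almost surely. -/
def IsStationaryMarkovChain {Ω S : Type*} [MeasurableSpace Ω] [mS : MeasurableSpace S]
    (ξ : ℤ → Ω → S) (hξ : ∀ k, Measurable (ξ k)) (μ : Measure Ω) : Prop :=
  IsStationary ξ μ ∧
  ∀ (k : ℤ) (A : Set S), MeasurableSet A →
    μ[(ξ (k + 1) ⁻¹' A).indicator (fun _ => (1 : ℝ)) | pastFiltration ξ hξ k] =ᵐ[μ]
      μ[(ξ (k + 1) ⁻¹' A).indicator (fun _ => (1 : ℝ)) | mS.comap (ξ k)]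

/-- `S_n = X_0 + ⋯ + X_{n-1}`. -/
def partialSum {Ω : Type*} (X : ℤ → Ω → ℝ) (n : ℕ) (ω : Ω) : ℝ :=
  ∑ i ∈ Finset.range n, X (i : ℤ) ω

/-- The condition `∑_{n ≥ 1} (log n / n) (∑_{k ≥ n} ‖E(S_k | ℱ₀)‖₂ / k^{3/2})² < ∞`, as a series
in `[0, ∞]`; in particular every inner series is finite. -/
def LogCondition {Ω : Type*} {_ : MeasurableSpace Ω} (μ : Measure Ω) (F₀ : MeasurableSpace Ω)
    (X : ℤ → Ω → ℝ) : Prop :=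
  ∑' n : Set.Ici (1 : ℕ), ENNReal.ofReal (Real.log (n : ℕ) / (n : ℕ)) *
    (∑' k : Set.Ici (n : ℕ),
      eLpNorm (μ[partialSum X (k : ℕ) | F₀]) 2 μ / ((k : ℕ) : ENNReal) ^ (3 / 2 : ℝ)) ^ 2 < ⊤

/-- `(D_k)_{k ∈ ℤ}` is a stationary sequence of square integrable martingale differences adapted to
`(ℱ_{k+1})`, and `M_n = D_0 + ⋯ + D_{n-1}` is a martingale with respect to `(ℱ_n)_{n ≥ 0}`. -/
structure IsStationaryMartingaleDiff {Ω : Type*} {mΩ : MeasurableSpace Ω} (μ : Measure Ω)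
    (ℱ : Filtration ℤ mΩ) (D : ℤ → Ω → ℝ) : Prop where
  adapted : ∀ k, StronglyMeasurable[ℱ (k + 1)] (D k)
  memLp : ∀ k, MemLp (D k) 2 μ
  stationary : IsStationary D μ
  condExp_eq_zero : ∀ k, μ[D k | ℱ k] =ᵐ[μ] 0
  martingale : Martingale (partialSum D) (natRestrict ℱ) μ

/-- `log₂ x = log (log (max (e, x)))`, the iterated logarithm. -/
noncomputable def log₂ (x : ℝ) : ℝ := Real.log (Real.log (max (Real.exp 1) x))

/-- `(S_n - M_n) / (n log₂ n)^{1/2} → 0` almost surely, where `S`, `M` are the partial sums of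
`X`, `D`. -/
def LogApprox {Ω : Type*} {_ : MeasurableSpace Ω} (μ : Measure Ω) (X D : ℤ → Ω → ℝ) : Prop :=
  ∀ᵐ ω ∂μ, Tendsto
    (fun n : ℕ => (partialSum X n ω - partialSum D n ω) / √((n : ℝ) * log₂ (n : ℝ)))
    atTop (𝓝 0)

end MartApprox

/-!
Let `U` be the isometry `g ↦ g ∘ T` of `L²` and `K = L²(ℱ₀)`, so that `K ⊆ U K`. With `P` the
projection onto `K` and `V = P U`, one has `E₀ Sₙ = (1 + V + ⋯ + V ^ (n - 1)) X₀`. Cesàro means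
`θ_m` of these sums solve the Poisson equation `X₀ = θ_m - V θ_m` up to a small remainder, and
`U θ_m - V θ_m` is a martingale difference; the partial sums of the remainder are controlled by the
dyadic doubling inequality of Peligrad and Utev. As `‖∑_{i < n} U ^ i d‖ = √n ‖d‖` for martingale
differences `d`, the differences `U θ_m - V θ_m` form a Cauchy sequence. Their limit `D₀` satisfies
`‖∑_{i < 2 ^ j} U ^ i (X₀ - D₀)‖ ≤ C 2 ^ (j / 2) τ_j` with
`τ_j = ∑_{k ≥ 2 ^ j} ‖E₀ S_k‖ / k ^ (3 / 2)`, and the logarithmic condition says that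
`∑_j (j + 1) τ_j² < ∞`.

To pass to almost sure bounds, decompose the `n`-th partial sum of `X₀ - D₀`, `n < 2 ^ r`, into
dyadic blocks. The Cauchy–Schwarz inequality with weights `1 / (j + 1)` costs a factor
`∑_{j < r} 1 / (j + 1) ∼ log r ∼ log log n`, and the remaining sum of squared block increments,
averaged over the starting points of the blocks, is a Birkhoff sum of an integrable function, which
the maximal ergodic theorem controls.

Functions of a stationary process reduce to the shift on its path space.
-/

namespace MartApprox

/-! ### Geometric sums of operators -/

section GeomSum

/-- The geometric sum `1 + x + ⋯ + x ^ (n - 1)`. For an operator `x = U` its value at `f` is the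
`n`-th partial sum of the orbit of `f`. -/
def geomSum {R : Type*} [Semiring R] (x : R) (n : ℕ) : R := ∑ i ∈ Finset.range n, x ^ i

section Semiring

variable {R : Type*} [Semiring R] (x : R)

@[simp]
theorem geomSum_zero : geomSum x 0 = 0 := Finset.sum_range_zero _

@[simp]
theorem geomSum_one : geomSum x 1 = 1 := by simp [geomSum]

theorem geomSum_succ (n : ℕ) : geomSum x (n + 1) = geomSum x n + x ^ n :=
  Finset.sum_range_succ _ _

theorem geomSum_add (m n : ℕ) : geomSum x (m + n) = geomSum x m + x ^ m * geomSum x n := by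
  simp only [geomSum, Finset.sum_range_add, pow_add, Finset.mul_sum]

theorem commute_geomSum_right {x y : R} (h : Commute y x) (n : ℕ) : Commute y (geomSum x n) :=
  Commute.sum_right _ _ _ fun j _ => h.pow_right j

theorem commute_geomSum_geomSum (m n : ℕ) : Commute (geomSum x m) (geomSum x n) :=
  commute_geomSum_right (commute_geomSum_right (Commute.refl x) m).symm n

end Semiring

section NormedSpace

variable {𝕜 E : Type*} [NormedField 𝕜] [NormedAddCommGroup E] [NormedSpace 𝕜 E] {V : E →L[𝕜] E}

theorem geomSum_apply (V : E →L[𝕜] E) (n : ℕ) (x : E) :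
    geomSum V n x = ∑ i ∈ Finset.range n, (V ^ i) x := by
  rw [geomSum, sum_apply]

theorem norm_pow_apply (hV : ∀ x, ‖V x‖ = ‖x‖) (n : ℕ) (x : E) : ‖(V ^ n) x‖ = ‖x‖ := by
  induction n with
  | zero => simp
  | succ n ih => rw [pow_succ', mul_apply_eq_comp, hV, ih]

theorem norm_pow_apply_le (hV : ∀ x, ‖V x‖ ≤ ‖x‖) (n : ℕ) (x : E) : ‖(V ^ n) x‖ ≤ ‖x‖ := by
  induction n with
  | zero => simp
  | succ n ih => rw [pow_succ', mul_apply_eq_comp]; exact (hV _).trans ih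

theorem norm_geomSum_apply_le (hV : ∀ x, ‖V x‖ ≤ ‖x‖) (n : ℕ) (x : E) :
    ‖geomSum V n x‖ ≤ n * ‖x‖ := by
  rw [geomSum_apply]
  simpa using norm_sum_le_of_le (Finset.range n) fun i _ => norm_pow_apply_le hV i x

theorem norm_geomSum_apply_le_add (hV : ∀ x, ‖V x‖ ≤ ‖x‖) (m n : ℕ) (x : E) :
    ‖geomSum V m x‖ ≤ ‖geomSum V (m + n) x‖ + ‖geomSum V n x‖ := by
  have h : geomSum V m x = geomSum V (m + n) x - (V ^ m) (geomSum V n x) := by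
    simp [geomSum_add]
  rw [h]
  exact (norm_sub_le _ _).trans (by gcongr; exact norm_pow_apply_le hV m _)

theorem geomSum_sub_apply (V : E →L[𝕜] E) (n : ℕ) (x : E) :
    geomSum V n (x - V x) = x - (V ^ n) x := by
  have h := congrArg (fun W : E →L[𝕜] E => W x) (geom_sum_mul_neg V n)
  simpa [geomSum] using h

end NormedSpace

section Cesaro

variable {𝕜 E : Type*} [RCLike 𝕜] [NormedAddCommGroup E] [NormedSpace 𝕜 E]

/-- The Cesàro averages of the partial sums of the Neumann series `∑ V ^ i f`: approximate
solutions `θ` of the Poisson equation `θ - V θ = f`. -/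
noncomputable def cesaroNeumann (V : E →L[𝕜] E) (m : ℕ) (f : E) : E :=
  (m : 𝕜)⁻¹ • ∑ i ∈ Finset.range m, geomSum V (i + 1) f

/-- The error `f - (θ - V θ)` of `θ = cesaroNeumann V m f` in the Poisson equation
(see `cesaroNeumann_sub_apply`). -/
noncomputable def poissonRemainder (V : E →L[𝕜] E) (m : ℕ) (f : E) : E :=
  (m : 𝕜)⁻¹ • V (geomSum V m f)

theorem cesaroNeumann_sub_apply (V : E →L[𝕜] E) {m : ℕ} (hm : m ≠ 0) (f : E) :
    cesaroNeumann V m f - V (cesaroNeumann V m f) = f - poissonRemainder V m f := by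
  have h (i : ℕ) : geomSum V i f - V (geomSum V i f) = f - (V ^ i) f := by
    rw [← geomSum_sub_apply, map_sub, ← mul_apply_eq_comp, ← mul_apply_eq_comp,
      (commute_geomSum_right (Commute.refl V) i).eq]
  have hsum : V (geomSum V m f) = ∑ i ∈ Finset.range m, (V ^ (i + 1)) f := by
    simp [geomSum_apply, pow_succ']
  have hm' : (m : 𝕜) ≠ 0 := Nat.cast_ne_zero.2 hm
  simp only [cesaroNeumann, poissonRemainder, hsum, map_smul, map_sum, ← smul_sub,
    ← Finset.sum_sub_distrib, h]
  rw [Finset.sum_sub_distrib, smul_sub, Finset.sum_const, Finset.card_range,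
    ← Nat.cast_smul_eq_nsmul 𝕜, inv_smul_smul₀ hm']

theorem norm_cesaroNeumann_le (V : E →L[𝕜] E) {m : ℕ} {f : E} {c : ℝ} (hc : 0 ≤ c)
    (h : ∀ i ≤ m, ‖geomSum V i f‖ ≤ c) : ‖cesaroNeumann V m f‖ ≤ c := by
  have hsum : ‖∑ i ∈ Finset.range m, geomSum V (i + 1) f‖ ≤ m * c := by
    simpa using norm_sum_le_of_le (Finset.range m) fun i hi => h _ (Finset.mem_range.1 hi)
  rw [cesaroNeumann, norm_smul, norm_inv, RCLike.norm_natCast]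
  exact inv_mul_le_of_le_mul₀ m.cast_nonneg hc hsum

theorem norm_geomSum_poissonRemainder_le {V : E →L[𝕜] E} (hV : ∀ x, ‖V x‖ ≤ ‖x‖) (k m : ℕ)
    (f : E) : ‖geomSum V k (poissonRemainder V m f)‖ ≤ (m : ℝ)⁻¹ * (k * ‖geomSum V m f‖) := by
  refine (norm_geomSum_apply_le hV k _).trans ?_
  rw [poissonRemainder, norm_smul, norm_inv, RCLike.norm_natCast, mul_left_comm]
  gcongr
  exact hV _

theorem norm_geomSum_poissonRemainder_le_norm_geomSum {V : E →L[𝕜] E} (hV : ∀ x, ‖V x‖ ≤ ‖x‖)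
    (k m : ℕ) (f : E) : ‖geomSum V k (poissonRemainder V m f)‖ ≤ ‖geomSum V k f‖ := by
  have hcomm : geomSum V k (V (geomSum V m f)) = V (geomSum V m (geomSum V k f)) := by
    have h : Commute (geomSum V k) (V * geomSum V m) :=
      (commute_geomSum_right (Commute.refl V) k).symm.mul_right (commute_geomSum_geomSum V k m)
    simpa using congrArg (fun W : E →L[𝕜] E => W f) h.eq
  rw [poissonRemainder, map_smul, norm_smul, norm_inv, RCLike.norm_natCast, hcomm]
  exact inv_mul_le_of_le_mul₀ m.cast_nonneg (norm_nonneg _)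
    ((hV _).trans (norm_geomSum_apply_le hV m _))

end Cesaro

end GeomSum

/-! ### Isometries and their compressions -/

section Compression

variable {𝕜 H : Type*} [RCLike 𝕜] [NormedAddCommGroup H] [InnerProductSpace 𝕜 H]
  {U : H →L[𝕜] H} {K : Submodule 𝕜 H}

theorem inner_pow_apply (hU : ∀ x, ‖U x‖ = ‖x‖) (n : ℕ) (x y : H) :
    inner 𝕜 ((U ^ n) x) ((U ^ n) y) = inner 𝕜 x y :=
  (LinearMap.norm_map_iff_inner_map_map (U ^ n)).1 (norm_pow_apply hU n) x y

theorem inner_apply_apply (hU : ∀ x, ‖U x‖ = ‖x‖) (x y : H) :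
    inner 𝕜 (U x) (U y) = inner 𝕜 x y :=
  (LinearMap.norm_map_iff_inner_map_map U).1 hU x y

theorem exists_pow_apply_eq_geomSum (hK : K ≤ K.map (U : H →ₗ[𝕜] H)) {x : H}
    (hx : x ∈ K.map (U : H →ₗ[𝕜] H)) (n : ℕ) : ∃ y ∈ K, (U ^ n) y = geomSum U n x := by
  induction n with
  | zero => exact ⟨0, K.zero_mem, by simp⟩
  | succ n ih =>
    obtain ⟨y, hy, hyx⟩ := ih
    obtain ⟨z, hz, rfl⟩ := hK hy
    obtain ⟨w, hw, rfl⟩ := hx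
    refine ⟨z + w, K.add_mem hz hw, ?_⟩
    rw [geomSum_succ, add_apply, ← hyx, map_add, pow_succ]
    rfl

variable [K.HasOrthogonalProjection]

/-- The compression of an operator to a subspace, seen as an operator on the whole space. For the
Koopman operator and `K = L²(ℱ₀)` it is `X ↦ E(X ∘ T | ℱ₀)`. -/
noncomputable def compression (K : Submodule 𝕜 H) [K.HasOrthogonalProjection] (U : H →L[𝕜] H) :
    H →L[𝕜] H := K.starProjection * U

theorem compression_apply_mem (x : H) : compression K U x ∈ K := K.starProjection_apply_mem _

theorem norm_compression_apply_le (hU : ∀ x, ‖U x‖ = ‖x‖) (x : H) :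
    ‖compression K U x‖ ≤ ‖x‖ :=
  (K.norm_starProjection_apply_le _).trans (hU x).le

theorem compression_mul_starProjection (hU : ∀ x, ‖U x‖ = ‖x‖)
    (hK : K ≤ K.map (U : H →ₗ[𝕜] H)) :
    compression K U * K.starProjection = K.starProjection * U := by
  ext x
  have h : K.starProjection (U (x - K.starProjection x)) = 0 := by
    rw [Submodule.starProjection_apply_eq_zero_iff, Submodule.mem_orthogonal']
    intro k hk
    obtain ⟨y, hy, rfl⟩ := hK hk
    exact (inner_apply_apply hU _ y).trans (K.starProjection_inner_eq_zero x y hy)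
  rw [map_sub, map_sub, sub_eq_zero] at h
  exact h.symm

theorem starProjection_mul_pow (hU : ∀ x, ‖U x‖ = ‖x‖) (hK : K ≤ K.map (U : H →ₗ[𝕜] H)) (n : ℕ) :
    K.starProjection * U ^ n = compression K U ^ n * K.starProjection := by
  induction n with
  | zero => simp
  | succ n ih =>
    rw [pow_succ', ← mul_assoc, ← compression_mul_starProjection hU hK, mul_assoc, ih,
      ← mul_assoc, pow_succ']

theorem starProjection_geomSum_apply (hU : ∀ x, ‖U x‖ = ‖x‖)
    (hK : K ≤ K.map (U : H →ₗ[𝕜] H)) (n : ℕ) {x : H} (hx : x ∈ K) :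
    K.starProjection (geomSum U n x) = geomSum (compression K U) n x := by
  rw [geomSum_apply, geomSum_apply, map_sum]
  refine Finset.sum_congr rfl fun i _ => ?_
  have h := congrArg (fun W : H →L[𝕜] H => W x) (starProjection_mul_pow hU hK i)
  simpa [K.starProjection_eq_self_iff.2 hx] using h

theorem geomSum_compression_apply_mem {x : H} (hx : x ∈ K) (n : ℕ) :
    geomSum (compression K U) n x ∈ K := by
  rw [geomSum_apply]
  refine K.sum_mem fun i _ => ?_
  cases i with
  | zero => simpa using hx
  | succ i => rw [pow_succ']; exact compression_apply_mem _

theorem cesaroNeumann_compression_mem {x : H} (hx : x ∈ K) (m : ℕ) :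
    cesaroNeumann (compression K U) m x ∈ K :=
  K.smul_mem _ (K.sum_mem fun _ _ => geomSum_compression_apply_mem hx _)

theorem poissonRemainder_compression_mem (m : ℕ) (x : H) :
    poissonRemainder (compression K U) m x ∈ K :=
  K.smul_mem _ (compression_apply_mem _)

theorem re_inner_geomSum_pow_geomSum_le (hU : ∀ x, ‖U x‖ = ‖x‖)
    (hK : K ≤ K.map (U : H →ₗ[𝕜] H)) {x : H} (hx : x ∈ K) (n : ℕ) :
    RCLike.re (inner 𝕜 (geomSum U n x) ((U ^ n) (geomSum U n x))) ≤
      ‖geomSum U n x‖ * ‖geomSum (compression K U) n x‖ := by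
  obtain ⟨y, hy, hyx⟩ := exists_pow_apply_eq_geomSum hK (hK hx) n
  have hproj : inner 𝕜 y (geomSum U n x) = inner 𝕜 y (geomSum (compression K U) n x) := by
    have h := K.starProjection_isSymmetric y (geomSum U n x)
    simpa [K.starProjection_eq_self_iff.2 hy, starProjection_geomSum_apply hU hK n hx] using h
  calc RCLike.re (inner 𝕜 (geomSum U n x) ((U ^ n) (geomSum U n x)))
      = RCLike.re (inner 𝕜 ((U ^ n) y) ((U ^ n) (geomSum U n x))) := by rw [hyx]
    _ = RCLike.re (inner 𝕜 y (geomSum (compression K U) n x)) := by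
      rw [inner_pow_apply hU, hproj]
    _ ≤ ‖y‖ * ‖geomSum (compression K U) n x‖ := re_inner_le_norm _ _
    _ = ‖geomSum U n x‖ * ‖geomSum (compression K U) n x‖ := by rw [← hyx, norm_pow_apply hU]

theorem norm_geomSum_two_mul_le (hU : ∀ x, ‖U x‖ = ‖x‖) (hK : K ≤ K.map (U : H →ₗ[𝕜] H)) {x : H}
    (hx : x ∈ K) (n : ℕ) :
    ‖geomSum U (2 * n) x‖ ≤
      √2 * (‖geomSum U n x‖ + ‖geomSum (compression K U) n x‖ / 2) := by
  have hsum : geomSum U (2 * n) x = geomSum U n x + (U ^ n) (geomSum U n x) := by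
    rw [two_mul, geomSum_add]; rfl
  have hinner := re_inner_geomSum_pow_geomSum_le hU hK hx n
  refine le_of_sq_le_sq ?_ (by positivity)
  rw [hsum, norm_add_sq (𝕜 := 𝕜), norm_pow_apply hU, mul_pow, Real.sq_sqrt zero_le_two]
  nlinarith [sq_nonneg ‖geomSum (compression K U) n x‖]

theorem norm_geomSum_two_pow_le (hU : ∀ x, ‖U x‖ = ‖x‖) (hK : K ≤ K.map (U : H →ₗ[𝕜] H)) {x : H}
    (hx : x ∈ K) (r : ℕ) :
    ‖geomSum U (2 ^ r) x‖ ≤ √2 ^ r * (‖x‖ + (∑ j ∈ Finset.range r,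
      (√2 ^ j)⁻¹ * ‖geomSum (compression K U) (2 ^ j) x‖) / 2) := by
  induction r with
  | zero => simp
  | succ r ih =>
    rw [pow_succ']
    refine (norm_geomSum_two_mul_le hU hK hx _).trans ?_
    rw [pow_succ' √2, mul_assoc, Finset.sum_range_succ]
    gcongr
    refine (add_le_add_left ih _).trans_eq ?_
    have : √2 ^ r ≠ 0 := by positivity
    field_simp
    ring

end Compression

/-! ### The innovation space -/

section Innovation

variable {𝕜 H : Type*} [RCLike 𝕜] [NormedAddCommGroup H] [InnerProductSpace 𝕜 H]
  {U : H →L[𝕜] H} {K : Submodule 𝕜 H}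

/-- The wandering subspace `U K ⊖ K`. For the Koopman operator and `K = L²(ℱ₀)` it consists of the
square integrable `ℱ₁`-measurable `D₀` with `E(D₀ | ℱ₀) = 0`. -/
def innovationSpace (U : H →L[𝕜] H) (K : Submodule 𝕜 H) : Submodule 𝕜 H :=
  K.map (U : H →ₗ[𝕜] H) ⊓ Kᗮ

theorem norm_geomSum_apply_of_mem_innovationSpace (hU : ∀ x, ‖U x‖ = ‖x‖)
    (hK : K ≤ K.map (U : H →ₗ[𝕜] H)) {d : H} (hd : d ∈ innovationSpace U K) (n : ℕ) :
    ‖geomSum U n d‖ = √n * ‖d‖ := by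
  have h : ‖geomSum U n d‖ ^ 2 = n * ‖d‖ ^ 2 := by
    induction n with
    | zero => simp
    | succ n ih =>
      have horth : inner 𝕜 (geomSum U n d) ((U ^ n) d) = 0 := by
        obtain ⟨y, hy, hyd⟩ := exists_pow_apply_eq_geomSum hK hd.1 n
        rw [← hyd, inner_pow_apply hU]
        exact K.mem_orthogonal d |>.1 hd.2 y hy
      rw [geomSum_succ, add_apply, norm_add_sq (𝕜 := 𝕜), horth, ih, norm_pow_apply hU]
      push_cast
      simp only [map_zero]
      ring
  rw [← Real.sqrt_sq (norm_nonneg (geomSum U n d)), h, Real.sqrt_mul n.cast_nonneg,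
    Real.sqrt_sq (norm_nonneg _)]

theorem sqrt_two_pow (n : ℕ) : √((2 ^ n : ℕ) : ℝ) = √2 ^ n := by
  rw [Nat.cast_pow, Nat.cast_ofNat, Real.sqrt_eq_iff_mul_self_eq (by positivity) (by positivity),
    ← mul_pow, Real.mul_self_sqrt zero_le_two]

theorem norm_le_of_eventually_norm_geomSum_le (hU : ∀ x, ‖U x‖ = ‖x‖)
    (hK : K ≤ K.map (U : H →ₗ[𝕜] H)) {d : H} (hd : d ∈ innovationSpace U K) {b c : ℝ}
    (h : ∀ᶠ r : ℕ in atTop, ‖geomSum U (2 ^ r) d‖ ≤ c + √2 ^ r * b) : ‖d‖ ≤ b := by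
  have hinv : Tendsto (fun r : ℕ => (√2 ^ r)⁻¹ * c + b) atTop (𝓝 (0 * c + b)) :=
    ((tendsto_inv_atTop_zero.comp (tendsto_pow_atTop_atTop_of_one_lt
      (Real.lt_sqrt_of_sq_lt (by norm_num)))).mul_const c).add_const b
  rw [zero_mul, zero_add] at hinv
  refine ge_of_tendsto hinv (h.mono fun r hr => ?_)
  rw [norm_geomSum_apply_of_mem_innovationSpace hU hK hd, sqrt_two_pow] at hr
  have hpos : 0 < √2 ^ r := by positivity
  rw [← mul_le_mul_iff_right₀ hpos, mul_add, mul_inv_cancel_left₀ hpos.ne']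
  exact hr

variable [K.HasOrthogonalProjection]

theorem isClosed_innovationSpace [CompleteSpace H] (hU : ∀ x, ‖U x‖ = ‖x‖) :
    IsClosed (innovationSpace U K : Set H) := by
  have hclosed : IsClosed (K : Set H) := by
    rw [← K.orthogonal_orthogonal]
    exact Kᗮ.isClosed_orthogonal
  have hmap := (AddMonoidHomClass.isometry_of_norm U hU).isClosedEmbedding.isClosedMap _ hclosed
  exact hmap.inter K.isClosed_orthogonal

/-- The martingale difference `U θ - E(U θ | K)` attached to the approximate solution
`θ = cesaroNeumann V m f` of the Poisson equation for the compression `V` of `U` to `K`. -/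
noncomputable def approxDiff (U : H →L[𝕜] H) (K : Submodule 𝕜 H) [K.HasOrthogonalProjection]
    (m : ℕ) (f : H) : H :=
  U (cesaroNeumann (compression K U) m f) -
    compression K U (cesaroNeumann (compression K U) m f)

theorem approxDiff_mem_innovationSpace (hK : K ≤ K.map (U : H →ₗ[𝕜] H)) {f : H} (hf : f ∈ K)
    (m : ℕ) : approxDiff U K m f ∈ innovationSpace U K :=
  ⟨Submodule.sub_mem _ ⟨_, cesaroNeumann_compression_mem hf m, rfl⟩
    (hK (compression_apply_mem _)), K.sub_starProjection_mem_orthogonal _⟩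

theorem geomSum_sub_approxDiff (U : H →L[𝕜] H) (K : Submodule 𝕜 H) [K.HasOrthogonalProjection]
    {m : ℕ} (hm : m ≠ 0) (n : ℕ) (f : H) :
    geomSum U n (f - approxDiff U K m f) =
      geomSum U n (poissonRemainder (compression K U) m f) +
        (cesaroNeumann (compression K U) m f - (U ^ n) (cesaroNeumann (compression K U) m f)) := by
  rw [← geomSum_sub_apply, ← map_add]
  congr 1
  rw [approxDiff, sub_eq_iff_eq_add, add_assoc, sub_add_sub_cancel,
    cesaroNeumann_sub_apply _ hm, add_sub_cancel]

end Innovation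

/-! ### Martingale approximation in a Hilbert space -/

section Approximation

/-- `e` controls `a` dyadically: `e s` bounds both `2 ^ (-s/2) * a i` for `i ≤ 2 ^ s` and the tail
`∑ j ≥ s, 2 ^ (-j/2) * a (2 ^ j)`. It is applied to `a n = ‖E(S_n | ℱ₀)‖`, with `e` the rate of the
martingale approximation. -/
structure DyadicControl (a e : ℕ → ℝ) : Prop where
  le_of_le : ∀ s, ∀ i ≤ 2 ^ s, a i ≤ √2 ^ s * e s
  sum_Ico_le : ∀ s r, ∑ j ∈ Finset.Ico s r, (√2 ^ j)⁻¹ * a (2 ^ j) ≤ e s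

theorem sum_sqrt_two_pow_le (s : ℕ) : ∑ j ∈ Finset.range s, √2 ^ j ≤ 3 * √2 ^ s := by
  induction s with
  | zero => simp
  | succ s ih =>
    rw [Finset.sum_range_succ, pow_succ]
    have h : (4 / 3 : ℝ) ≤ √2 := Real.le_sqrt_of_sq_le (by norm_num)
    nlinarith [pow_pos (Real.sqrt_pos.2 (zero_lt_two' ℝ)) s]

theorem sqrt_two_pow_mul_self (n : ℕ) : √2 ^ n * √2 ^ n = 2 ^ n := by
  rw [← mul_pow, Real.mul_self_sqrt zero_le_two]

namespace DyadicControl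

variable {a b e : ℕ → ℝ}

theorem nonneg (h : DyadicControl a e) (s : ℕ) : 0 ≤ e s := by
  simpa using h.sum_Ico_le s s

theorem inv_two_pow_mul_le (h : DyadicControl a e) (s : ℕ) :
    (2 ^ s : ℝ)⁻¹ * a (2 ^ s) ≤ (√2 ^ s)⁻¹ * e s := by
  have hs := h.le_of_le s _ le_rfl
  have hpos : 0 < √2 ^ s := by positivity
  rw [← sqrt_two_pow_mul_self, mul_inv, mul_assoc]
  gcongr
  rwa [inv_mul_le_iff₀ hpos]

theorem sum_range_le (h : DyadicControl a e) {s r : ℕ} (hsr : s ≤ r) (hba : ∀ k, b k ≤ a k)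
    (hb : ∀ k : ℕ, b k ≤ (2 ^ s : ℝ)⁻¹ * (k * a (2 ^ s))) :
    ∑ j ∈ Finset.range r, (√2 ^ j)⁻¹ * b (2 ^ j) ≤ 4 * e s := by
  have hpos (j : ℕ) : 0 < √2 ^ j := by positivity
  have hsmall (j : ℕ) : (√2 ^ j)⁻¹ * b (2 ^ j) ≤ √2 ^ j * ((√2 ^ s)⁻¹ * e s) := by
    rw [inv_mul_le_iff₀ (hpos j), ← mul_assoc, sqrt_two_pow_mul_self]
    refine (hb _).trans ?_
    rw [mul_left_comm, Nat.cast_pow, Nat.cast_ofNat]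
    exact mul_le_mul_of_nonneg_left (h.inv_two_pow_mul_le s) (by positivity)
  have hhead : ∑ j ∈ Finset.range s, (√2 ^ j)⁻¹ * b (2 ^ j) ≤ 3 * e s := by
    refine (Finset.sum_le_sum fun j _ => hsmall j).trans ?_
    rw [← Finset.sum_mul, mul_comm (√2 ^ s)⁻¹, ← mul_assoc, ← div_eq_mul_inv, div_le_iff₀ (hpos s),
      mul_right_comm]
    exact mul_le_mul_of_nonneg_right (sum_sqrt_two_pow_le s) (h.nonneg s)
  have htail : ∑ j ∈ Finset.Ico s r, (√2 ^ j)⁻¹ * b (2 ^ j) ≤ e s :=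
    (Finset.sum_le_sum fun j _ => by gcongr; exact hba _).trans (h.sum_Ico_le s r)
  rw [← Finset.sum_range_add_sum_Ico _ hsr]
  linarith

end DyadicControl

variable {𝕜 H : Type*} [RCLike 𝕜] [NormedAddCommGroup H] [InnerProductSpace 𝕜 H]
  {U : H →L[𝕜] H} {K : Submodule 𝕜 H} [K.HasOrthogonalProjection] {f : H} {e : ℕ → ℝ}

theorem norm_geomSum_poissonRemainder_compression_le (hU : ∀ x, ‖U x‖ = ‖x‖)
    (hK : K ≤ K.map (U : H →ₗ[𝕜] H))
    (h : DyadicControl (fun n => ‖geomSum (compression K U) n f‖) e) {s r : ℕ} (hsr : s ≤ r) :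
    ‖geomSum U (2 ^ r) (poissonRemainder (compression K U) (2 ^ s) f)‖ ≤
      √2 ^ r * (3 * e s) := by
  have hV := norm_compression_apply_le (K := K) hU
  have hrem (k : ℕ) : ‖geomSum (compression K U) k (poissonRemainder (compression K U) (2 ^ s) f)‖
      ≤ (2 ^ s : ℝ)⁻¹ * (k * ‖geomSum (compression K U) (2 ^ s) f‖) := by
    simpa using norm_geomSum_poissonRemainder_le hV k (2 ^ s) f
  have hnorm : ‖poissonRemainder (compression K U) (2 ^ s) f‖ ≤ e s := by
    have h1 : (1 : ℝ) ≤ √2 ^ s := one_le_pow₀ (Real.one_le_sqrt.2 one_le_two)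
    refine le_trans ?_ ((h.inv_two_pow_mul_le s).trans
      (mul_le_of_le_one_left (h.nonneg s) (inv_le_one_of_one_le₀ h1)))
    simpa using hrem 1
  have hsum := h.sum_range_le hsr
    (norm_geomSum_poissonRemainder_le_norm_geomSum hV · (2 ^ s) f) hrem
  refine (norm_geomSum_two_pow_le hU hK (poissonRemainder_compression_mem _ f) r).trans ?_
  gcongr
  linarith

theorem norm_geomSum_sub_approxDiff_le (hU : ∀ x, ‖U x‖ = ‖x‖)
    (hK : K ≤ K.map (U : H →ₗ[𝕜] H))
    (h : DyadicControl (fun n => ‖geomSum (compression K U) n f‖) e) {s r : ℕ} (hsr : s ≤ r) :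
    ‖geomSum U (2 ^ r) (f - approxDiff U K (2 ^ s) f)‖ ≤
      2 * (√2 ^ s * e s) + √2 ^ r * (3 * e s) := by
  set θ := cesaroNeumann (compression K U) (2 ^ s) f
  have hθ : ‖θ‖ ≤ √2 ^ s * e s :=
    norm_cesaroNeumann_le _ (mul_nonneg (by positivity) (h.nonneg s)) (h.le_of_le s)
  have hcob : ‖θ - (U ^ 2 ^ r) θ‖ ≤ 2 * (√2 ^ s * e s) := by
    refine (norm_sub_le _ _).trans ?_
    rw [norm_pow_apply hU]
    linarith
  rw [geomSum_sub_approxDiff U K (by positivity), add_comm]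
  exact norm_add_le_of_le hcob (norm_geomSum_poissonRemainder_compression_le hU hK h hsr)

theorem norm_approxDiff_sub_approxDiff_le (hU : ∀ x, ‖U x‖ = ‖x‖)
    (hK : K ≤ K.map (U : H →ₗ[𝕜] H)) (hf : f ∈ K)
    (h : DyadicControl (fun n => ‖geomSum (compression K U) n f‖) e) (s t : ℕ) :
    ‖approxDiff U K (2 ^ s) f - approxDiff U K (2 ^ t) f‖ ≤ 3 * (e s + e t) := by
  refine norm_le_of_eventually_norm_geomSum_le hU hK
    (c := 2 * (√2 ^ s * e s) + 2 * (√2 ^ t * e t))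
    (Submodule.sub_mem _ (approxDiff_mem_innovationSpace hK hf _)
      (approxDiff_mem_innovationSpace hK hf _)) ?_
  filter_upwards [eventually_ge_atTop s, eventually_ge_atTop t] with r hs ht
  rw [← sub_sub_sub_cancel_left _ _ f, map_sub]
  refine (norm_sub_le_of_le (norm_geomSum_sub_approxDiff_le hU hK h ht)
    (norm_geomSum_sub_approxDiff_le hU hK h hs)).trans_eq ?_
  ring

theorem exists_mem_innovationSpace_norm_geomSum_sub_le [CompleteSpace H]
    (hU : ∀ x, ‖U x‖ = ‖x‖) (hK : K ≤ K.map (U : H →ₗ[𝕜] H)) (hf : f ∈ K)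
    (h : DyadicControl (fun n => ‖geomSum (compression K U) n f‖) e)
    (he : Tendsto e atTop (𝓝 0)) :
    ∃ d ∈ innovationSpace U K, ∀ s, ‖geomSum U (2 ^ s) (f - d)‖ ≤ √2 ^ s * (8 * e s) := by
  set D : ℕ → H := fun s => approxDiff U K (2 ^ s) f
  have hD (s : ℕ) : D s ∈ innovationSpace U K := approxDiff_mem_innovationSpace hK hf _
  have hclose := norm_approxDiff_sub_approxDiff_le hU hK hf h
  have hcauchy : CauchySeq D := by
    refine Metric.cauchySeq_iff'.2 fun ε hε => ?_
    obtain ⟨N, hN⟩ := (he.eventually_lt_const (show 0 < ε / 6 by positivity)).exists_forall_of_atTop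
    refine ⟨N, fun n hn => ?_⟩
    rw [dist_eq_norm]
    linarith [hclose n N, hN n hn, hN N le_rfl]
  obtain ⟨d, hlim⟩ := cauchySeq_tendsto_of_complete hcauchy
  have hd : d ∈ innovationSpace U K :=
    (isClosed_innovationSpace hU).mem_of_tendsto hlim (Eventually.of_forall hD)
  refine ⟨d, hd, fun s => ?_⟩
  have hdist : ‖D s - d‖ ≤ 3 * (e s + 0) :=
    le_of_tendsto_of_tendsto (tendsto_const_nhds.sub hlim).norm
      ((tendsto_const_nhds.add he).const_mul _) (Eventually.of_forall (hclose s))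
  have hinnov : ‖geomSum U (2 ^ s) (D s - d)‖ ≤ √2 ^ s * (3 * (e s + 0)) := by
    rw [norm_geomSum_apply_of_mem_innovationSpace hU hK (Submodule.sub_mem _ (hD s) hd),
      sqrt_two_pow]
    gcongr
  rw [← sub_add_sub_cancel f (D s) d, map_add]
  refine (norm_add_le_of_le (norm_geomSum_sub_approxDiff_le hU hK h le_rfl) hinnov).trans_eq ?_
  ring

end Approximation

/-! ### Tail sums and dyadic blocks -/

section Sequences

/-- The tail sum `w n + w (n + 1) + ⋯`. -/
noncomputable def tailSum (w : ℕ → ℝ) (n : ℕ) : ℝ := ∑' k, w (k + n)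

variable {a c u v w : ℕ → ℝ}

theorem tailSum_nonneg (hw : ∀ k, 0 ≤ w k) (n : ℕ) : 0 ≤ tailSum w n := tsum_nonneg fun _ => hw _

theorem tendsto_tailSum_two_pow (w : ℕ → ℝ) :
    Tendsto (fun s => tailSum w (2 ^ s)) atTop (𝓝 0) :=
  (tendsto_sum_nat_add w).comp (tendsto_pow_atTop_atTop_of_one_lt one_lt_two)

theorem sum_Ico_eq_tailSum_sub (hs : Summable w) {m n : ℕ} (hmn : m ≤ n) :
    ∑ k ∈ Finset.Ico m n, w k = tailSum w m - tailSum w n := by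
  rw [Finset.sum_Ico_eq_sub _ hmn, tailSum, tailSum]
  linarith [hs.sum_add_tsum_nat_add m, hs.sum_add_tsum_nat_add n]

theorem tailSum_antitone (hw : ∀ k, 0 ≤ w k) (hs : Summable w) : Antitone (tailSum w) := by
  intro m n hmn
  rw [← sub_nonneg, ← sum_Ico_eq_tailSum_sub hs hmn]
  exact Finset.sum_nonneg fun _ _ => hw _

theorem mul_le_two_mul_sum_Ico (ha : ∀ k, 0 ≤ a k) (hsub : ∀ i k, a i ≤ a (i + k) + a k)
    {i n : ℕ} (hi : i ≤ n) : n * a i ≤ 2 * ∑ k ∈ Finset.Ico n (4 * n), a k := by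
  calc (n : ℝ) * a i = ∑ _k ∈ Finset.Ico n (2 * n), a i := by
        rw [Finset.sum_const, Nat.card_Ico, nsmul_eq_mul, two_mul, Nat.add_sub_cancel]
    _ ≤ ∑ k ∈ Finset.Ico n (2 * n), (a (i + k) + a k) := Finset.sum_le_sum fun k _ => hsub i k
    _ = ∑ k ∈ Finset.Ico (n + i) (2 * n + i), a k + ∑ k ∈ Finset.Ico n (2 * n), a k := by
        rw [Finset.sum_add_distrib, Finset.sum_Ico_add]
    _ ≤ ∑ k ∈ Finset.Ico n (4 * n), a k + ∑ k ∈ Finset.Ico n (4 * n), a k := by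
        refine add_le_add ?_ ?_ <;>
          exact Finset.sum_le_sum_of_subset_of_nonneg
            (Finset.Ico_subset_Ico (by omega) (by omega)) fun _ _ _ => ha _
    _ = 2 * ∑ k ∈ Finset.Ico n (4 * n), a k := (two_mul _).symm

theorem rpow_three_halves_le {x y : ℝ} (hx : 0 ≤ x) (hy : 0 < y) (hxy : x ≤ 4 * y) :
    x ^ (3 / 2 : ℝ) ≤ 8 * (y * √y) := by
  calc x ^ (3 / 2 : ℝ) ≤ ((2 : ℝ) ^ (2 : ℝ) * y) ^ (3 / 2 : ℝ) :=
        Real.rpow_le_rpow hx (hxy.trans_eq (by norm_num)) (by norm_num)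
    _ = 8 * (y * √y) := by
        rw [Real.mul_rpow (by positivity) hy.le, ← Real.rpow_mul (by norm_num),
          show (3 / 2 : ℝ) = 1 + 1 / 2 by norm_num, Real.rpow_add hy, Real.rpow_one,
          ← Real.sqrt_eq_rpow]
        norm_num

/-- The terms `a k / k ^ (3 / 2)` of the Maxwell–Woodroofe series of `a k = ‖E(S_k | ℱ₀)‖`. -/
noncomputable def maxwellWoodroofeTerm (a : ℕ → ℝ) (k : ℕ) : ℝ := a k / (k : ℝ) ^ (3 / 2 : ℝ)

theorem maxwellWoodroofeTerm_nonneg (ha : ∀ k, 0 ≤ a k) (k : ℕ) : 0 ≤ maxwellWoodroofeTerm a k :=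
  div_nonneg (ha k) (by positivity)

theorem le_sqrt_mul_sum_of_le_add (ha : ∀ k, 0 ≤ a k) (hsub : ∀ i k, a i ≤ a (i + k) + a k)
    {i n : ℕ} (hn : 0 < n) (hi : i ≤ n) :
    a i ≤ 16 * √n * ∑ k ∈ Finset.Ico n (4 * n), maxwellWoodroofeTerm a k := by
  have hn0 : (0 : ℝ) < n := Nat.cast_pos.2 hn
  have hterm : ∀ k ∈ Finset.Ico n (4 * n), a k ≤ 8 * (n * √n) * maxwellWoodroofeTerm a k := by
    intro k hk
    rw [Finset.mem_Ico] at hk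
    have hk0 : (0 : ℝ) < k := Nat.cast_pos.2 (by omega)
    rw [maxwellWoodroofeTerm, mul_div_assoc', le_div_iff₀ (by positivity), mul_comm]
    exact mul_le_mul_of_nonneg_right
      (rpow_three_halves_le hk0.le hn0 (by exact_mod_cast hk.2.le)) (ha k)
  have hsum := Finset.sum_le_sum hterm
  rw [← Finset.mul_sum] at hsum
  refine le_of_mul_le_mul_left ?_ hn0
  linarith [mul_le_two_mul_sum_Ico ha hsub hi]

theorem le_sqrt_two_pow_mul_tailSum_sub (ha : ∀ k, 0 ≤ a k)
    (hsub : ∀ i k, a i ≤ a (i + k) + a k) (hs : Summable (maxwellWoodroofeTerm a)) {s i : ℕ}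
    (hi : i ≤ 2 ^ s) :
    a i ≤ √2 ^ s * (16 * (tailSum (maxwellWoodroofeTerm a) (2 ^ s) -
      tailSum (maxwellWoodroofeTerm a) (2 ^ (s + 2)))) := by
  have hpow : 2 ^ (s + 2) = 4 * 2 ^ s := by ring
  refine (le_sqrt_mul_sum_of_le_add ha hsub (by positivity) hi).trans_eq ?_
  rw [sqrt_two_pow, sum_Ico_eq_tailSum_sub hs (by omega), hpow]
  ring

theorem dyadicControl_tailSum (ha : ∀ k, 0 ≤ a k) (hsub : ∀ i k, a i ≤ a (i + k) + a k)
    (hs : Summable (maxwellWoodroofeTerm a)) :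
    DyadicControl a fun s => 32 * tailSum (maxwellWoodroofeTerm a) (2 ^ s) := by
  have hw := maxwellWoodroofeTerm_nonneg ha
  have hblock {s i : ℕ} := le_sqrt_two_pow_mul_tailSum_sub ha hsub hs (s := s) (i := i)
  set F : ℕ → ℝ := fun s => tailSum (maxwellWoodroofeTerm a) (2 ^ s)
  set G : ℕ → ℝ := fun j => 16 * (F j + F (j + 1))
  have hF0 (j : ℕ) : 0 ≤ F j := tailSum_nonneg hw _
  refine ⟨fun s i hi => (hblock hi).trans (mul_le_mul_of_nonneg_left ?_ (by positivity)),
    fun s r => ?_⟩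
  · linarith [hF0 (s + 2), hF0 s]
  · have hterm (j : ℕ) : (√2 ^ j)⁻¹ * a (2 ^ j) ≤ G j - G (j + 1) := by
      rw [inv_mul_le_iff₀ (by positivity)]
      refine (hblock le_rfl).trans_eq ?_
      ring
    have hF : F (s + 1) ≤ F s :=
      tailSum_antitone hw hs (Nat.pow_le_pow_right two_pos s.le_succ)
    have htel := Finset.sum_range_sub' (fun j => G (s + j)) (r - s)
    simp only [← add_assoc, add_zero] at htel
    rw [Finset.sum_Ico_eq_sum_range]
    refine (Finset.sum_le_sum fun j _ => hterm (s + j)).trans ?_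
    rw [htel]
    linarith [hF0 (s + (r - s)), hF0 (s + (r - s) + 1)]

theorem summable_of_forall_le_two_pow_mul (hu : Summable u) (hu0 : ∀ n, 0 ≤ u n)
    (hv0 : ∀ r, 0 ≤ v r) (h : ∀ r, ∀ n ∈ Finset.Ico (2 ^ r) (2 ^ (r + 1)), v r ≤ 2 ^ r * u n) :
    Summable v := by
  have hblock (r : ℕ) : v r ≤ tailSum u (2 ^ r) - tailSum u (2 ^ (r + 1)) := by
    have hsum := Finset.card_nsmul_le_sum _ _ _ (h r)
    rw [Nat.card_Ico, pow_succ, mul_two, Nat.add_sub_cancel, nsmul_eq_mul, Nat.cast_pow,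
      ← Finset.mul_sum, Nat.cast_ofNat, mul_le_mul_iff_right₀ (by positivity)] at hsum
    rwa [pow_succ, mul_two, ← sum_Ico_eq_tailSum_sub hu (Nat.le_add_left _ _)]
  refine summable_of_sum_range_le (c := tailSum u (2 ^ 0)) hv0 fun R => ?_
  refine (Finset.sum_le_sum fun r _ => hblock r).trans ?_
  rw [Finset.sum_range_sub' (fun r => tailSum u (2 ^ r)) R]
  linarith [tailSum_nonneg hu0 (2 ^ R)]

theorem summable_mul_tailSum_two_pow (hw : ∀ k, 0 ≤ w k) (hs : Summable w)
    (hlog : Summable fun n : ℕ => Real.log n / n * tailSum w n ^ 2) :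
    Summable fun j : ℕ => ((j : ℝ) + 1) * tailSum w (2 ^ j) ^ 2 := by
  have hsum : Summable fun r : ℕ => Real.log 2 / 2 * (r * tailSum w (2 ^ (r + 1)) ^ 2) := by
    refine summable_of_forall_le_two_pow_mul hlog (fun n => mul_nonneg
      (div_nonneg (Real.log_natCast_nonneg n) n.cast_nonneg) (sq_nonneg _))
      (fun r => by positivity) fun r n hn => ?_
    rw [Finset.mem_Ico] at hn
    have hn0 : 0 < n := lt_of_lt_of_le (by positivity) hn.1
    have hlogn : (r : ℝ) * Real.log 2 ≤ Real.log n := by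
      rw [← Real.log_pow]
      exact Real.log_le_log (by positivity) (by exact_mod_cast hn.1)
    have hle : (n : ℝ) ≤ 2 ^ (r + 1) := by exact_mod_cast hn.2.le
    have htail : tailSum w (2 ^ (r + 1)) ≤ tailSum w n := tailSum_antitone hw hs hn.2.le
    have htail0 := tailSum_nonneg hw (2 ^ (r + 1))
    calc Real.log 2 / 2 * (r * tailSum w (2 ^ (r + 1)) ^ 2)
        = 2 ^ r * (r * Real.log 2 / 2 ^ (r + 1) * tailSum w (2 ^ (r + 1)) ^ 2) := by
          field_simp
          ring
      _ ≤ 2 ^ r * (Real.log n / n * tailSum w n ^ 2) := by gcongr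
  rw [summable_mul_left_iff (by positivity)] at hsum
  refine (summable_nat_add_iff 2).1 (Summable.of_nonneg_of_le (fun j => by positivity)
    (fun j => ?_) (((summable_nat_add_iff 1).2 hsum).mul_left 4))
  push_cast
  rw [← mul_assoc]
  gcongr
  linarith [(Nat.cast_nonneg j : (0 : ℝ) ≤ j)]

/-- The translation equivalence `k ↦ k + n` between `ℕ` and the integers that are at least `n`. -/
def natEquivIci (n : ℕ) : ℕ ≃ Set.Ici n where
  toFun k := ⟨k + n, Nat.le_add_left n k⟩
  invFun k := k - n
  left_inv k := by simp
  right_inv k := Subtype.ext (Nat.sub_add_cancel k.2)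

theorem tsum_Ici_eq_tsum_add {M : Type*} [AddCommMonoid M] [TopologicalSpace M] (g : ℕ → M)
    (n : ℕ) : ∑' k : Set.Ici n, g k = ∑' k, g (k + n) :=
  ((natEquivIci n).tsum_eq fun k : Set.Ici n => g k).symm

theorem tsum_Ici_ofReal (hw : ∀ k, 0 ≤ w k) (hs : Summable w) (n : ℕ) :
    ∑' k : Set.Ici n, ENNReal.ofReal (w k) = ENNReal.ofReal (tailSum w n) := by
  rw [tsum_Ici_eq_tsum_add (fun k => ENNReal.ofReal (w k)), tailSum,
    ENNReal.ofReal_tsum_of_nonneg (fun k => hw _) ((summable_nat_add_iff n).2 hs)]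

theorem summable_of_tsum_Ici_ofReal_ne_top (hw : ∀ k, 0 ≤ w k) {n : ℕ}
    (h : ∑' k : Set.Ici n, ENNReal.ofReal (w k) ≠ ⊤) : Summable w := by
  rw [tsum_Ici_eq_tsum_add (fun k => ENNReal.ofReal (w k))] at h
  have hsum := ENNReal.summable_toReal h
  simp only [ENNReal.toReal_ofReal (hw _)] at hsum
  exact (summable_nat_add_iff n).1 hsum

theorem summable_of_tsum_Ici_mul_sq_lt_top (hc : ∀ n, 0 ≤ c n) (hw : ∀ k, 0 ≤ w k) {l m : ℕ}
    (hlm : l ≤ m) (hm : 0 < c m)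
    (h : ∑' n : Set.Ici l, ENNReal.ofReal (c n) *
      (∑' k : Set.Ici (n : ℕ), ENNReal.ofReal (w k)) ^ 2 < ⊤) :
    Summable w ∧ Summable fun n => c n * tailSum w n ^ 2 := by
  have hs : Summable w := by
    refine summable_of_tsum_Ici_ofReal_ne_top hw (n := m) fun htop => ?_
    refine ENNReal.ne_top_of_tsum_ne_top h.ne ⟨m, hlm⟩ ?_
    rw [htop, ENNReal.top_pow two_ne_zero, ENNReal.mul_top (ENNReal.ofReal_pos.2 hm).ne']
  refine ⟨hs, summable_of_tsum_Ici_ofReal_ne_top (n := l)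
    (fun n => mul_nonneg (hc n) (sq_nonneg _)) ?_⟩
  simpa only [tsum_Ici_ofReal hw hs, ENNReal.ofReal_mul (hc _),
    ENNReal.ofReal_pow (tailSum_nonneg hw _)] using h.ne

theorem ofReal_div_natCast_rpow {x : ℝ} {k : ℕ} (hk : 0 < k) (p : ℝ) :
    ENNReal.ofReal x / (k : ENNReal) ^ p = ENNReal.ofReal (x / (k : ℝ) ^ p) := by
  have hk0 : (0 : ℝ) < k := Nat.cast_pos.2 hk
  rw [ENNReal.ofReal_div_of_pos (by positivity), ← ENNReal.ofReal_natCast,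
    ENNReal.ofReal_rpow_of_pos hk0]

end Sequences

/-! ### The maximal ergodic inequality -/

section MaximalErgodic

variable {Ω : Type*} {mΩ : MeasurableSpace Ω} {μ : Measure Ω} {T : Ω → Ω} {f g : Ω → ℝ}

/-- The maximum of the Birkhoff sums of `f` of length at most `N`, by recursion along the orbit. -/
noncomputable def birkhoffMax (T : Ω → Ω) (f : Ω → ℝ) : ℕ → Ω → ℝ
  | 0 => 0
  | N + 1 => fun ω => max 0 (f ω + birkhoffMax T f N (T ω))

theorem birkhoffMax_nonneg (N : ℕ) (ω : Ω) : 0 ≤ birkhoffMax T f N ω := by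
  cases N with
  | zero => exact le_rfl
  | succ N => exact le_max_left _ _

theorem birkhoffMax_le_succ (N : ℕ) (ω : Ω) :
    birkhoffMax T f N ω ≤ birkhoffMax T f (N + 1) ω := by
  induction N generalizing ω with
  | zero => exact birkhoffMax_nonneg _ _
  | succ N ih => exact max_le_max le_rfl (by gcongr; exact ih _)

theorem birkhoffSum_le_birkhoffMax (n : ℕ) (ω : Ω) :
    birkhoffSum T f n ω ≤ birkhoffMax T f n ω := by
  induction n generalizing ω with
  | zero => simp [birkhoffMax]
  | succ n ih =>
    rw [birkhoffSum_succ']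
    exact le_max_of_le_right (by gcongr; exact ih _)

theorem birkhoffMax_sub_comp_le_indicator (N : ℕ) (ω : Ω) :
    birkhoffMax T f N ω - birkhoffMax T f N (T ω) ≤
      {ω | 0 < birkhoffMax T f N ω}.indicator f ω := by
  rcases (birkhoffMax_nonneg (T := T) (f := f) N ω).eq_or_lt with h0 | hpos
  · rw [Set.indicator_of_notMem (by simp [← h0]), ← h0, zero_sub, neg_nonpos]
    exact birkhoffMax_nonneg _ _
  · have hmem : ω ∈ {ω | 0 < birkhoffMax T f N ω} := hpos
    rw [Set.indicator_of_mem hmem, sub_le_iff_le_add]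
    cases N with
    | zero => exact absurd hpos (lt_irrefl _)
    | succ N =>
      have hmax : birkhoffMax T f (N + 1) ω = f ω + birkhoffMax T f N (T ω) :=
        max_eq_right ((lt_max_iff.1 hpos).resolve_left (lt_irrefl _)).le
      rw [hmax]
      gcongr
      exact birkhoffMax_le_succ _ _

theorem integrable_birkhoffMax (hT : MeasurePreserving T μ μ) (hf : Integrable f μ) (N : ℕ) :
    Integrable (birkhoffMax T f N) μ := by
  induction N with
  | zero => exact integrable_zero _ _ _
  | succ N ih =>
    exact (integrable_zero _ _ _).sup (hf.add (hT.integrable_comp_of_integrable ih))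

theorem setIntegral_birkhoffMax_pos_nonneg (hT : MeasurePreserving T μ μ) (hf : Integrable f μ)
    (N : ℕ) : 0 ≤ ∫ ω in {ω | 0 < birkhoffMax T f N ω}, f ω ∂μ := by
  set M := birkhoffMax T f N
  have hM : Integrable M μ := integrable_birkhoffMax hT hf N
  have hMT : Integrable (fun ω => M (T ω)) μ := hT.integrable_comp_of_integrable hM
  have hpos : NullMeasurableSet {ω | 0 < M ω} μ :=
    nullMeasurableSet_lt aemeasurable_const hM.aemeasurable
  have hinv : ∫ ω, M (T ω) ∂μ = ∫ ω, M ω ∂μ := by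
    rw [← integral_map hT.measurable.aemeasurable (hT.map_eq.symm ▸ hM.aestronglyMeasurable),
      hT.map_eq]
  calc 0 = ∫ ω, (M ω - M (T ω)) ∂μ := by rw [integral_sub hM hMT, hinv, sub_self]
    _ ≤ ∫ ω, {ω | 0 < M ω}.indicator f ω ∂μ :=
      integral_mono (hM.sub hMT) (hf.indicator₀ hpos) (birkhoffMax_sub_comp_le_indicator N)
    _ = ∫ ω in {ω | 0 < M ω}, f ω ∂μ := integral_indicator₀ hpos

theorem measure_exists_lt_birkhoffSum_le [IsFiniteMeasure μ] (hT : MeasurePreserving T μ μ)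
    (hg : Integrable g μ) (hg0 : 0 ≤ᵐ[μ] g) {c : ℝ} (hc : 0 < c) :
    μ {ω | ∃ n : ℕ, n * c < birkhoffSum T g n ω} ≤ ENNReal.ofReal ((∫ ω, g ω ∂μ) / c) := by
  set f : Ω → ℝ := fun ω => g ω - c
  have hf : Integrable f μ := hg.sub (integrable_const c)
  have hmono : Monotone fun N => {ω | 0 < birkhoffMax T f N ω} :=
    monotone_nat_of_le_succ fun N ω hω => lt_of_lt_of_le hω (birkhoffMax_le_succ N ω)
  have hsub : {ω | ∃ n : ℕ, n * c < birkhoffSum T g n ω} ⊆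
      ⋃ N, {ω | 0 < birkhoffMax T f N ω} := by
    rintro ω ⟨n, hn⟩
    refine Set.mem_iUnion.2 ⟨n, lt_of_lt_of_le ?_ (birkhoffSum_le_birkhoffMax n ω)⟩
    have hsum : birkhoffSum T f n ω = birkhoffSum T g n ω - n * c := by simp [birkhoffSum, f]
    rw [hsum]
    linarith
  have hbound (N : ℕ) : μ {ω | 0 < birkhoffMax T f N ω} ≤ ENNReal.ofReal ((∫ ω, g ω ∂μ) / c) := by
    have hopf := setIntegral_birkhoffMax_pos_nonneg hT hf N
    rw [integral_sub hg.integrableOn (integrable_const c), setIntegral_const, smul_eq_mul] at hopf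
    rw [← ofReal_measureReal]
    refine ENNReal.ofReal_le_ofReal ((le_div_iff₀ hc).2 ?_)
    linarith [setIntegral_le_integral (s := {ω | 0 < birkhoffMax T f N ω}) hg hg0]
  refine (measure_mono hsub).trans ?_
  rw [hmono.measure_iUnion]
  exact iSup_le hbound

variable {F : ℕ → Ω → ℝ}

theorem measure_exists_lt_sum_birkhoffSum_le [IsFiniteMeasure μ] (hT : MeasurePreserving T μ μ)
    (hF : ∀ j, Integrable (F j) μ) (hF0 : ∀ j ω, 0 ≤ F j ω)
    (hs : Summable fun j => ∫ ω, F j ω ∂μ) {c : ℝ} (hc : 0 < c) (J : ℕ) :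
    μ {ω | ∃ r n : ℕ, n * c < ∑ j ∈ Finset.Ico J r, birkhoffSum T (F j) n ω} ≤
      ENNReal.ofReal (tailSum (fun j => ∫ ω, F j ω ∂μ) J / c) := by
  set G : ℕ → Ω → ℝ := fun r ω => ∑ j ∈ Finset.Ico J r, F j ω
  have hI0 (j : ℕ) : 0 ≤ ∫ ω, F j ω ∂μ := integral_nonneg (hF0 j)
  have hsum (r n : ℕ) (ω : Ω) :
      ∑ j ∈ Finset.Ico J r, birkhoffSum T (F j) n ω = birkhoffSum T (G r) n ω := Finset.sum_comm
  have hmono : Monotone fun r => {ω | ∃ n : ℕ, n * c < birkhoffSum T (G r) n ω} := by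
    refine fun r s hrs ω ⟨n, hn⟩ => ⟨n, hn.trans_le (Finset.sum_le_sum fun i _ => ?_)⟩
    exact Finset.sum_le_sum_of_subset_of_nonneg (Finset.Ico_subset_Ico_right hrs)
      fun j _ _ => hF0 j _
  have hbound (r : ℕ) : ∫ ω, G r ω ∂μ ≤ tailSum (fun j => ∫ ω, F j ω ∂μ) J := by
    rw [integral_finsetSum _ fun j _ => hF j]
    rcases le_total J r with hJr | hrJ
    · rw [sum_Ico_eq_tailSum_sub hs hJr]
      exact sub_le_self _ (tailSum_nonneg hI0 r)
    · rw [Finset.Ico_eq_empty_of_le hrJ, Finset.sum_empty]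
      exact tailSum_nonneg hI0 J
  simp only [hsum, Set.ofPred_exists (p := fun r ω => ∃ n : ℕ, n * c < birkhoffSum T (G r) n ω)]
  rw [hmono.measure_iUnion]
  refine iSup_le fun r => (measure_exists_lt_birkhoffSum_le hT
    (integrable_finsetSum _ fun j _ => hF j)
    (Eventually.of_forall fun ω => Finset.sum_nonneg fun j _ => hF0 j ω) hc).trans ?_
  gcongr
  exact hbound r

theorem ae_exists_sum_birkhoffSum_le [IsFiniteMeasure μ] (hT : MeasurePreserving T μ μ)
    (hF : ∀ j, Integrable (F j) μ) (hF0 : ∀ j ω, 0 ≤ F j ω)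
    (hs : Summable fun j => ∫ ω, F j ω ∂μ) {c : ℕ → ℝ} (hc : ∀ m, 0 < c m) {J : ℕ → ℕ}
    (hlim : Tendsto (fun m => tailSum (fun j => ∫ ω, F j ω ∂μ) (J m) / c m) atTop (𝓝 0)) :
    ∀ᵐ ω ∂μ, ∃ m, ∀ r n : ℕ, ∑ j ∈ Finset.Ico (J m) r, birkhoffSum T (F j) n ω ≤ n * c m := by
  rw [ae_iff]
  have hzero := ENNReal.tendsto_ofReal hlim
  rw [ENNReal.ofReal_zero] at hzero
  refine le_antisymm (ge_of_tendsto' hzero fun m => ?_) zero_le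
  refine le_trans (measure_mono fun ω hω => ?_)
    (measure_exists_lt_sum_birkhoffSum_le hT hF hF0 hs (hc m) (J m))
  simp only [Set.mem_ofPred_eq, not_exists, not_forall, not_le] at hω
  exact hω m

end MaximalErgodic

/-! ### Dyadic chaining -/

section Chaining

variable {E : Type*} [NormedAddCommGroup E]

/-- The weighted mean square `(j + 1) 2⁻ʲ ∑_{i < N} ‖x (i + 2ʲ) - x i‖²` of the increments of `x`
over intervals of length `2ʲ`, all starting points `i < N` being allowed. -/
noncomputable def incrementEnergy (x : ℕ → E) (j N : ℕ) : ℝ :=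
  ((j : ℝ) + 1) * (2 ^ j)⁻¹ * ∑ i ∈ Finset.range N, ‖x (i + 2 ^ j) - x i‖ ^ 2

theorem incrementEnergy_nonneg (x : ℕ → E) (j N : ℕ) : 0 ≤ incrementEnergy x j N :=
  mul_nonneg (by positivity) (Finset.sum_nonneg fun _ _ => sq_nonneg _)

theorem sqrt_mul_incrementEnergy (x : ℕ → E) (j N : ℕ) :
    √((j : ℝ) + 1)⁻¹ * √(incrementEnergy x j N) =
      √((2 ^ j)⁻¹ * ∑ i ∈ Finset.range N, ‖x (i + 2 ^ j) - x i‖ ^ 2) := by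
  rw [← Real.sqrt_mul (by positivity), incrementEnergy, mul_assoc,
    inv_mul_cancel_left₀ (by positivity)]

variable [NormedSpace ℝ E]

/-- The average of `x` over the `2 ^ r` consecutive integers from `a` on. -/
noncomputable def blockAvg (x : ℕ → E) (r a : ℕ) : E :=
  (2 ^ r : ℝ)⁻¹ • ∑ i ∈ Finset.range (2 ^ r), x (a + i)

theorem blockAvg_zero (x : ℕ → E) (a : ℕ) : blockAvg x 0 a = x a := by simp [blockAvg]

theorem blockAvg_succ (x : ℕ → E) (r a : ℕ) :
    blockAvg x (r + 1) a = (2 : ℝ)⁻¹ • (blockAvg x r a + blockAvg x r (a + 2 ^ r)) := by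
  rw [blockAvg, blockAvg, blockAvg, pow_succ (2 : ℕ) r, mul_two, Finset.sum_range_add, pow_succ,
    mul_inv_rev, mul_smul, smul_add (2 ^ r : ℝ)⁻¹]
  simp only [add_assoc]

theorem norm_blockAvg_sub_le (x : ℕ → E) {r a N : ℕ} (h : a + 2 ^ r ≤ N) :
    ‖blockAvg x r (a + 2 ^ r) - blockAvg x r a‖ ≤
      √((r : ℝ) + 1)⁻¹ * √(incrementEnergy x r N) := by
  rw [sqrt_mul_incrementEnergy]
  refine Real.le_sqrt_of_sq_le ?_
  set y : ℕ → E := fun i => x (i + 2 ^ r) - x i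
  have hdiff : blockAvg x r (a + 2 ^ r) - blockAvg x r a =
      (2 ^ r : ℝ)⁻¹ • ∑ i ∈ Finset.range (2 ^ r), y (a + i) := by
    rw [blockAvg, blockAvg, ← smul_sub, ← Finset.sum_sub_distrib]
    simp only [y, add_right_comm]
  have hcauchy : ‖∑ i ∈ Finset.range (2 ^ r), y (a + i)‖ ^ 2 ≤
      2 ^ r * ∑ i ∈ Finset.range (2 ^ r), ‖y (a + i)‖ ^ 2 := by
    refine (pow_le_pow_left₀ (norm_nonneg _) (norm_sum_le _ _) 2).trans ?_
    simpa using sq_sum_le_card_mul_sum_sq (s := Finset.range (2 ^ r)) (f := fun i => ‖y (a + i)‖)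
  have hsub : ∑ i ∈ Finset.range (2 ^ r), ‖y (a + i)‖ ^ 2 ≤ ∑ i ∈ Finset.range N, ‖y i‖ ^ 2 := by
    have hIco := Finset.sum_Ico_eq_sum_range (fun i => ‖y i‖ ^ 2) a (a + 2 ^ r)
    rw [Nat.add_sub_cancel_left] at hIco
    rw [← hIco]
    refine Finset.sum_le_sum_of_subset_of_nonneg (fun i hi => ?_) fun _ _ _ => sq_nonneg _
    exact Finset.mem_range.2 ((Finset.mem_Ico.1 hi).2.trans_le h)
  rw [hdiff, norm_smul, norm_inv, norm_pow, Real.norm_ofNat, mul_pow]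
  calc ((2 : ℝ) ^ r)⁻¹ ^ 2 * ‖∑ i ∈ Finset.range (2 ^ r), y (a + i)‖ ^ 2
      ≤ ((2 : ℝ) ^ r)⁻¹ ^ 2 * (2 ^ r * ∑ i ∈ Finset.range N, ‖y i‖ ^ 2) := by
        gcongr
        exact hcauchy.trans (by gcongr)
    _ = (2 ^ r)⁻¹ * ∑ i ∈ Finset.range N, ‖y i‖ ^ 2 := by
        rw [sq, mul_assoc, inv_mul_cancel_left₀ (by positivity)]

theorem norm_half_blockAvg_sub_le (x : ℕ → E) {r a N : ℕ} (h : a + 2 ^ r ≤ N) :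
    ‖blockAvg x r a - blockAvg x (r + 1) a‖ ≤
        √((r : ℝ) + 1)⁻¹ * √(incrementEnergy x r N) / 2 ∧
      ‖blockAvg x r (a + 2 ^ r) - blockAvg x (r + 1) a‖ ≤
        √((r : ℝ) + 1)⁻¹ * √(incrementEnergy x r N) / 2 := by
  have hle := norm_blockAvg_sub_le x h
  have hhalf (v w : E) : v - (2 : ℝ)⁻¹ • (v + w) = (2 : ℝ)⁻¹ • (v - w) := by module
  have hnorm (v w : E) : ‖v - (2 : ℝ)⁻¹ • (v + w)‖ = ‖v - w‖ / 2 := by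
    rw [hhalf, norm_smul, norm_inv, Real.norm_ofNat, inv_mul_eq_div]
  rw [blockAvg_succ]
  constructor
  · rw [hnorm, norm_sub_rev]
    gcongr
  · rw [add_comm (blockAvg x r a), hnorm]
    gcongr

theorem norm_sub_blockAvg_le (x : ℕ → E) {N : ℕ} (r a k : ℕ) (hak : a ≤ k) (hk : k < a + 2 ^ r)
    (hN : a + 2 ^ r ≤ N) :
    ‖x k - blockAvg x r a‖ ≤
      (∑ j ∈ Finset.range r, √((j : ℝ) + 1)⁻¹ * √(incrementEnergy x j N)) / 2 := by
  induction r generalizing a with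
  | zero =>
    obtain rfl : k = a := by rw [pow_zero] at hk; omega
    simp [blockAvg_zero]
  | succ r ih =>
    rw [pow_succ] at hk hN
    obtain ⟨hleft, hright⟩ := norm_half_blockAvg_sub_le x (r := r) (a := a) (N := N) (by omega)
    rw [Finset.sum_range_succ, add_div]
    rcases lt_or_ge k (a + 2 ^ r) with hlt | hge
    · exact (norm_sub_le_norm_sub_add_norm_sub _ _ _).trans
        (add_le_add (ih a hak hlt (by omega)) hleft)
    · exact (norm_sub_le_norm_sub_add_norm_sub _ _ _).trans
        (add_le_add (ih (a + 2 ^ r) hge (by omega) (by omega)) hright)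

theorem norm_sub_le_sum_sqrt_incrementEnergy (x : ℕ → E) {r k : ℕ} (hk : k < 2 ^ r) :
    ‖x k - x 0‖ ≤ ∑ j ∈ Finset.range r,
      √((j : ℝ) + 1)⁻¹ * √(incrementEnergy x j (2 ^ r)) := by
  have hkavg := norm_sub_blockAvg_le x r 0 k (Nat.zero_le _) (by omega) (N := 2 ^ r) (by omega)
  have h0avg := norm_sub_blockAvg_le x r 0 0 le_rfl (by positivity) (N := 2 ^ r) (by omega)
  rw [norm_sub_rev] at h0avg
  linarith [norm_sub_le_norm_sub_add_norm_sub (x k) (blockAvg x r 0) (x 0)]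

theorem sum_inv_succ_le (r : ℕ) : ∑ j ∈ Finset.range r, ((j : ℝ) + 1)⁻¹ ≤ 1 + Real.log r := by
  simpa [harmonic] using harmonic_le_one_add_log r

theorem norm_sub_le_of_incrementEnergy_le (x : ℕ → E) {C δ : ℝ} {J k r : ℕ} (hk : k < 2 ^ r)
    (hC : ∀ j, incrementEnergy x j (2 ^ r) ≤ 2 ^ r * C)
    (hδ : ∑ j ∈ Finset.Ico J r, incrementEnergy x j (2 ^ r) ≤ 2 ^ r * δ) :
    ‖x k - x 0‖ ≤ √(2 ^ r) * (J * √C + √δ * √(1 + Real.log r)) := by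
  set t : ℕ → ℝ := fun j => √((j : ℝ) + 1)⁻¹ * √(incrementEnergy x j (2 ^ r))
  have ht0 (j : ℕ) : 0 ≤ t j := by positivity
  have hsmall : ∑ j ∈ Finset.range J, t j ≤ J * (√(2 ^ r) * √C) := by
    refine (Finset.sum_le_card_nsmul _ _ (√(2 ^ r) * √C) fun j _ => ?_).trans_eq (by simp)
    rw [← Real.sqrt_mul (by positivity) C]
    refine (mul_le_of_le_one_left (Real.sqrt_nonneg _) ?_).trans (Real.sqrt_le_sqrt (hC j))
    exact Real.sqrt_le_one.2 (inv_le_one_of_one_le₀ (le_add_of_nonneg_left j.cast_nonneg))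
  have hlarge : ∑ j ∈ Finset.Ico J r, t j ≤ √(1 + Real.log r) * (√(2 ^ r) * √δ) := by
    refine (Real.sum_sqrt_mul_sqrt_le _ (fun j => by positivity)
      fun j => incrementEnergy_nonneg x j _).trans ?_
    rw [← Real.sqrt_mul (by positivity) δ]
    gcongr
    refine le_trans (Finset.sum_le_sum_of_subset_of_nonneg (fun j hj => ?_)
      fun _ _ _ => by positivity) (sum_inv_succ_le r)
    exact Finset.mem_range.2 (Finset.mem_Ico.1 hj).2
  have hsplit : ∑ j ∈ Finset.range r, t j ≤
      ∑ j ∈ Finset.range J, t j + ∑ j ∈ Finset.Ico J r, t j := by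
    rw [← Finset.sum_union (Finset.disjoint_left.2 fun j => by simp +contextual)]
    exact Finset.sum_le_sum_of_subset_of_nonneg (fun j => by simp; omega) fun j _ _ => ht0 j
  linarith [norm_sub_le_sum_sqrt_incrementEnergy x hk]

end Chaining

/-! ### The iterated logarithm -/

section IteratedLog

theorem one_le_log_max_exp_one (x : ℝ) : 1 ≤ Real.log (max (Real.exp 1) x) :=
  (Real.le_log_iff_exp_le (lt_max_of_lt_left (Real.exp_pos 1))).2 (le_max_left _ _)

theorem tendsto_log₂_atTop : Tendsto log₂ atTop atTop :=
  Real.tendsto_log_atTop.comp <| Real.tendsto_log_atTop.comp <|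
    tendsto_atTop_mono (fun x => le_max_right (Real.exp 1) x) tendsto_id

theorem log_natLog_add_one_le (n : ℕ) : Real.log ((Nat.log 2 n + 1 : ℕ) : ℝ) ≤ 2 + log₂ n := by
  set L := Real.log (max (Real.exp 1) n)
  have hL : 1 ≤ L := one_le_log_max_exp_one n
  have hlogn : Real.log n ≤ L := by
    rcases n.eq_zero_or_pos with rfl | hn
    · simpa using zero_le_one.trans hL
    · exact Real.log_le_log (by positivity) (le_max_right _ _)
  have hnatLog : (Nat.log 2 n : ℝ) * Real.log 2 ≤ Real.log n :=
    (le_div_iff₀ (Real.log_pos one_lt_two)).1 (Real.natLog_le_logb n 2)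
  have hlog2 : 1 / 2 ≤ Real.log 2 := by linarith [Real.log_two_gt_d9]
  have hmul : (Nat.log 2 n : ℝ) * (1 / 2) ≤ Nat.log 2 n * Real.log 2 := by gcongr
  have hexp : 3 ≤ Real.exp 2 := by linarith [Real.add_one_le_exp (2 : ℝ)]
  calc Real.log ((Nat.log 2 n + 1 : ℕ) : ℝ) ≤ Real.log (Real.exp 2 * L) := by
        refine Real.log_le_log (by positivity) ?_
        push_cast
        nlinarith
    _ = 2 + log₂ n := by rw [Real.log_mul (Real.exp_pos 2).ne' (by linarith), Real.log_exp]; rfl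

variable {E : Type*} [NormedAddCommGroup E]

theorem isLittleO_sqrt_mul_log₂_of_dyadic_bound {x : ℕ → E}
    (h : ∀ ε > 0, ∃ B, ∀ r k : ℕ, k < 2 ^ r → ‖x k‖ ≤ √(2 ^ r) * (B + ε * √(1 + Real.log r))) :
    x =o[atTop] fun n : ℕ => √(n * log₂ n) := by
  refine Asymptotics.IsLittleO.of_bound fun c hc => ?_
  obtain ⟨B, hB⟩ := h (c / 3) (by positivity)
  have hlog₂ : Tendsto (fun n : ℕ => log₂ n) atTop atTop :=
    tendsto_log₂_atTop.comp tendsto_natCast_atTop_atTop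
  filter_upwards [eventually_ne_atTop 0, hlog₂.eventually_ge_atTop 3,
    (Real.tendsto_sqrt_atTop.comp hlog₂).eventually_ge_atTop (√2 * B / (c / 3))] with n hn hL hBL
  set r := Nat.log 2 n + 1
  have hpow : (2 : ℝ) ^ r ≤ 2 * n := by
    rw [pow_succ, mul_comm]
    gcongr
    exact_mod_cast Nat.pow_log_le_self 2 hn
  have hlogr : 1 + Real.log r ≤ 2 * log₂ n := by linarith [log_natLog_add_one_le n]
  rw [div_le_iff₀' (by positivity), Function.comp_apply] at hBL
  rw [Real.norm_of_nonneg (Real.sqrt_nonneg _)]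
  calc ‖x n‖ ≤ √(2 ^ r) * (B + c / 3 * √(1 + Real.log r)) :=
        hB r n (Nat.lt_pow_succ_log_self one_lt_two n)
    _ ≤ √(2 ^ r) * (c / 3 * √(log₂ n) / √2 + c / 3 * √(2 * log₂ n)) := by
        gcongr
        rwa [le_div_iff₀' (by positivity)]
    _ ≤ √(2 * n) * (c / 3 * √(log₂ n) / √2 + c / 3 * √(2 * log₂ n)) := by gcongr
    _ = √n * (c / 3 * √(log₂ n) + c / 3 * (√2 * √2) * √(log₂ n)) := by
        rw [Real.sqrt_mul zero_le_two, Real.sqrt_mul zero_le_two]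
        field_simp
    _ = c * √(n * log₂ n) := by
        rw [Real.mul_self_sqrt zero_le_two, Real.sqrt_mul n.cast_nonneg]
        ring

theorem isLittleO_sub_of_incrementEnergy_le [NormedSpace ℝ E] {x : ℕ → E} {C : ℝ}
    (hC : ∀ j N, incrementEnergy x j N ≤ N * C)
    (hδ : ∀ δ > 0, ∃ J, ∀ r N, ∑ j ∈ Finset.Ico J r, incrementEnergy x j N ≤ N * δ) :
    (fun n => x n - x 0) =o[atTop] fun n : ℕ => √(n * log₂ n) := by
  refine isLittleO_sqrt_mul_log₂_of_dyadic_bound fun ε hε => ?_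
  obtain ⟨J, hJ⟩ := hδ (ε ^ 2) (by positivity)
  refine ⟨J * √C, fun r k hk => ?_⟩
  have hbound := norm_sub_le_of_incrementEnergy_le x hk
    (fun j => by simpa using hC j (2 ^ r)) (by simpa using hJ r (2 ^ r))
  rwa [Real.sqrt_sq hε.le] at hbound

end IteratedLog

/-! ### Almost sure growth of Birkhoff sums -/

section DyadicSums

variable {Ω E : Type*} {mΩ : MeasurableSpace Ω} {μ : Measure Ω} {T : Ω → Ω}
  [NormedAddCommGroup E] {Y : Ω → E}

theorem memLp_birkhoffSum {p : ENNReal} (hT : MeasurePreserving T μ μ) (hY : MemLp Y p μ)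
    (n : ℕ) : MemLp (birkhoffSum T Y n) p μ :=
  memLp_finsetSum (f := fun k ω => Y (T^[k] ω)) (Finset.range n) fun k _ =>
    hY.comp_measurePreserving (hT.iterate k)

/-- The normalized square `(j + 1) 2⁻ʲ ‖Y + ⋯ + Y ∘ T ^ (2ʲ - 1)‖²`; its Birkhoff sums are the
increment energies of the sequence of Birkhoff sums of `Y`. -/
noncomputable def dyadicSq (T : Ω → Ω) (Y : Ω → E) (j : ℕ) (ω : Ω) : ℝ :=
  ((j : ℝ) + 1) * (2 ^ j)⁻¹ * ‖birkhoffSum T Y (2 ^ j) ω‖ ^ 2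

theorem dyadicSq_nonneg (j : ℕ) (ω : Ω) : 0 ≤ dyadicSq T Y j ω := by
  unfold dyadicSq; positivity

theorem integrable_dyadicSq (hT : MeasurePreserving T μ μ) (hY : MemLp Y 2 μ) (j : ℕ) :
    Integrable (dyadicSq T Y j) μ :=
  ((memLp_birkhoffSum hT hY _).integrable_norm_pow two_ne_zero).const_mul _

theorem incrementEnergy_birkhoffSum (j N : ℕ) (ω : Ω) :
    incrementEnergy (fun n => birkhoffSum T Y n ω) j N = birkhoffSum T (dyadicSq T Y j) N ω := by
  simp only [incrementEnergy, birkhoffSum_add, add_sub_cancel_left, Finset.mul_sum]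
  rfl

theorem ae_isLittleO_birkhoffSum [NormedSpace ℝ E] [IsFiniteMeasure μ]
    (hT : MeasurePreserving T μ μ) (hY : MemLp Y 2 μ)
    (hs : Summable fun j => ∫ ω, dyadicSq T Y j ω ∂μ) :
    ∀ᵐ ω ∂μ, (fun n => birkhoffSum T Y n ω) =o[atTop] fun n : ℕ => √(n * log₂ n) := by
  have hall : ∀ᵐ ω ∂μ, ∃ m : ℕ, ∀ r n : ℕ,
      ∑ j ∈ Finset.Ico 0 r, birkhoffSum T (dyadicSq T Y j) n ω ≤ n * ((m : ℝ) + 1) := by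
    refine ae_exists_sum_birkhoffSum_le hT (integrable_dyadicSq hT hY) dyadicSq_nonneg hs
      (fun m => by positivity) (J := fun _ => 0) ?_
    exact tendsto_const_nhds.div_atTop
      (tendsto_atTop_add_const_right _ _ tendsto_natCast_atTop_atTop)
  have htail : ∀ᵐ ω ∂μ, ∀ p : ℕ, ∃ J : ℕ, ∀ r n : ℕ,
      ∑ j ∈ Finset.Ico J r, birkhoffSum T (dyadicSq T Y j) n ω ≤ n * (1 / ((p : ℝ) + 1)) := by
    refine ae_all_iff.2 fun p => ae_exists_sum_birkhoffSum_le hT (integrable_dyadicSq hT hY)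
      dyadicSq_nonneg hs (fun _ => by positivity) (J := id) ?_
    simpa [tailSum] using (tendsto_sum_nat_add fun j => ∫ ω, dyadicSq T Y j ω ∂μ).div_const
      (1 / ((p : ℝ) + 1))
  filter_upwards [hall, htail] with ω ⟨m, hm⟩ hω
  have hlittle := isLittleO_sub_of_incrementEnergy_le (x := fun n => birkhoffSum T Y n ω)
    (C := (m : ℝ) + 1) (fun j N => ?_) fun δ hδ => ?_
  · simpa using hlittle
  · rw [incrementEnergy_birkhoffSum]
    refine le_trans ?_ (hm (j + 1) N)
    exact Finset.single_le_sum (f := fun j => birkhoffSum T (dyadicSq T Y j) N ω)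
      (fun j _ => Finset.sum_nonneg fun i _ => dyadicSq_nonneg j _) (by simp)
  · obtain ⟨p, hp⟩ := exists_nat_one_div_lt hδ
    obtain ⟨J, hJ⟩ := hω p
    refine ⟨J, fun r N => ?_⟩
    simp only [incrementEnergy_birkhoffSum]
    exact (hJ r N).trans (by gcongr)

theorem integral_dyadicSq (hT : MeasurePreserving T μ μ) (hY : MemLp Y 2 μ) (j : ℕ) :
    ∫ ω, dyadicSq T Y j ω ∂μ =
      ((j : ℝ) + 1) * (2 ^ j)⁻¹ * lpNorm (birkhoffSum T Y (2 ^ j)) 2 μ ^ 2 := by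
  simp only [dyadicSq]
  rw [integral_const_mul, lpNorm_eq_integral_norm_rpow_toReal two_ne_zero ENNReal.ofNat_ne_top
    (memLp_birkhoffSum hT hY _).aestronglyMeasurable, ENNReal.toReal_ofNat,
    ← Real.rpow_mul_natCast (integral_nonneg fun ω => by positivity)]
  simp

theorem summable_integral_dyadicSq (hT : MeasurePreserving T μ μ) (hY : MemLp Y 2 μ)
    {b : ℕ → ℝ} (hb : ∀ j, lpNorm (birkhoffSum T Y (2 ^ j)) 2 μ ≤ √2 ^ j * b j)
    (hs : Summable fun j : ℕ => ((j : ℝ) + 1) * b j ^ 2) :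
    Summable fun j => ∫ ω, dyadicSq T Y j ω ∂μ := by
  refine hs.of_nonneg_of_le (fun j => integral_nonneg fun ω => dyadicSq_nonneg j ω) fun j => ?_
  rw [integral_dyadicSq hT hY, mul_assoc]
  gcongr
  rw [inv_mul_le_iff₀ (by positivity), ← sqrt_two_pow_mul_self, ← sq, ← mul_pow]
  exact pow_le_pow_left₀ lpNorm_nonneg (hb j) 2

end DyadicSums

/-! ### The Koopman operator and conditional expectations -/

section Koopman

variable {Ω E : Type*} {m mΩ : MeasurableSpace Ω} {μ : Measure Ω} {T : Ω → Ω}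
  [NormedAddCommGroup E] [NormedSpace ℝ E] {p : ENNReal}

theorem toLp_mem_lpMeas {g : Ω → E} (hg : MemLp g p μ)
    (hgm : AEStronglyMeasurable[m] g μ) : hg.toLp ∈ lpMeas E ℝ m p μ :=
  mem_lpMeas_iff_aestronglyMeasurable.2 (hgm.congr hg.coeFn_toLp.symm)

theorem exists_stronglyMeasurable_toLp_eq {x : Lp E p μ}
    (hx : x ∈ lpMeas E ℝ m p μ) :
    ∃ (g : Ω → E) (hg : MemLp g p μ), StronglyMeasurable[m] g ∧ hg.toLp = x := by
  obtain ⟨g, hgm, hxg⟩ := mem_lpMeas_iff_aestronglyMeasurable.1 hx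
  have hg : MemLp g p μ := (memLp_congr_ae hxg).1 (Lp.memLp x)
  exact ⟨g, hg, hgm, Lp.ext (hg.coeFn_toLp.trans hxg.symm)⟩

variable [Fact (1 ≤ p)]

/-- The Koopman operator `g ↦ g ∘ T` of a measure preserving map, on `Lᵖ`. -/
noncomputable def koopman (hT : MeasurePreserving T μ μ) : Lp E p μ →L[ℝ] Lp E p μ :=
  (Lp.compMeasurePreservingₗᵢ ℝ T hT).toContinuousLinearMap

theorem norm_koopman_apply (hT : MeasurePreserving T μ μ) (g : Lp E p μ) : ‖koopman hT g‖ = ‖g‖ :=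
  (Lp.compMeasurePreservingₗᵢ ℝ T hT).norm_map g

theorem koopman_toLp (hT : MeasurePreserving T μ μ) {g : Ω → E} (hg : MemLp g p μ) :
    koopman hT hg.toLp = (hg.comp_measurePreserving hT).toLp := rfl

theorem koopman_pow_toLp (hT : MeasurePreserving T μ μ) {g : Ω → E} (hg : MemLp g p μ) (n : ℕ) :
    (koopman hT ^ n) hg.toLp = (hg.comp_measurePreserving (hT.iterate n)).toLp := by
  induction n with
  | zero => rfl
  | succ n ih =>
    rw [pow_succ', mul_apply_eq_comp, ih, koopman_toLp]
    rfl

theorem geomSum_koopman_toLp (hT : MeasurePreserving T μ μ) {g : Ω → E} (hg : MemLp g p μ)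
    (n : ℕ) : geomSum (koopman hT) n hg.toLp = (memLp_birkhoffSum hT hg n).toLp := by
  induction n with
  | zero => simp [geomSum_zero]
  | succ n ih =>
    rw [geomSum_succ, add_apply, ih, koopman_pow_toLp, ← MemLp.toLp_add]
    refine MemLp.toLp_congr _ _ (Eventually.of_forall fun ω => ?_)
    rw [birkhoffSum_succ]
    rfl

theorem lpMeas_le_map_koopman [CompleteSpace E] (hm : m ≤ mΩ)
    (hmT : m ≤ m.comap T) (hT : MeasurePreserving T μ μ) :
    lpMeas E ℝ m p μ ≤ (lpMeas E ℝ m p μ).map (koopman hT).toLinearMap := by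
  intro x hx
  obtain ⟨g, hg, hgm, rfl⟩ := exists_stronglyMeasurable_toLp_eq hx
  obtain ⟨h, hhm, rfl⟩ := (hgm.mono hmT).exists_eq_measurable_comp (mY := m)
  have hh : MemLp h p μ := by
    have hmap := memLp_map_measure_iff (μ := μ) (p := p) (f := T) (g := h)
      (hhm.mono hm).aestronglyMeasurable hT.measurable.aemeasurable
    rw [hT.map_eq] at hmap
    exact hmap.2 hg
  exact ⟨hh.toLp, toLp_mem_lpMeas hh hhm.aestronglyMeasurable, koopman_toLp hT hh⟩

end Koopman

section CondExp

variable {Ω E : Type*} {m mΩ : MeasurableSpace Ω} {μ : Measure Ω} [IsFiniteMeasure μ] {T : Ω → Ω}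
  [NormedAddCommGroup E]

theorem condExp_comp_measurePreserving [NormedSpace ℝ E] [CompleteSpace E] {Ω' : Type*}
    {mΩ' : MeasurableSpace Ω'} {ν : Measure Ω'} [IsFiniteMeasure ν] {φ : Ω' → Ω}
    (hφ : MeasurePreserving φ ν μ) (hm : m ≤ mΩ) {g : Ω → E} (hg : Integrable g μ) :
    ν[g ∘ φ | m.comap φ] =ᵐ[ν] μ[g | m] ∘ φ := by
  have hset {h : Ω → E} (hh : Integrable h μ) {A : Set Ω} (hA : MeasurableSet[m] A) :
      ∫ ω in φ ⁻¹' A, (h ∘ φ) ω ∂ν = ∫ x in A, h x ∂μ := by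
    rw [← hφ.map_eq, setIntegral_map (hm A hA) (hφ.map_eq.symm ▸ hh.aestronglyMeasurable)
      hφ.measurable.aemeasurable]
    rfl
  refine (ae_eq_condExp_of_forall_setIntegral_eq
    ((MeasurableSpace.comap_mono hm).trans hφ.measurable.comap_le)
    (hφ.integrable_comp_of_integrable hg)
    (fun s _ _ => (hφ.integrable_comp_of_integrable integrable_condExp).integrableOn) ?_
    (stronglyMeasurable_condExp.comp_measurable (comap_measurable φ)).aestronglyMeasurable).symm
  rintro s ⟨A, hA, rfl⟩ -
  rw [hset integrable_condExp hA, hset hg hA, setIntegral_condExp hm hg hA]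

variable [InnerProductSpace ℝ E] [CompleteSpace E] [hm : Fact (m ≤ mΩ)] {X : Ω → E}

theorem starProjection_lpMeas_toLp_ae_eq {g : Ω → E} (hg : MemLp g 2 μ) :
    (lpMeas E ℝ m 2 μ).starProjection hg.toLp =ᵐ[μ] μ[g | m] :=
  hg.condExpL2_ae_eq_condExp (𝕜 := ℝ) hm.out

theorem lpNorm_condExp {g : Ω → E} (hg : MemLp g 2 μ) :
    lpNorm (μ[g | m]) 2 μ = ‖(lpMeas E ℝ m 2 μ).starProjection hg.toLp‖ := by
  rw [Lp.norm_def, eLpNorm_congr_ae (starProjection_lpMeas_toLp_ae_eq hg),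
    toReal_eLpNorm integrable_condExp.aestronglyMeasurable]

theorem lpNorm_condExp_birkhoffSum (hmT : m ≤ m.comap T) (hT : MeasurePreserving T μ μ)
    (hX : AEStronglyMeasurable[m] X μ) (hX2 : MemLp X 2 μ) (n : ℕ) :
    lpNorm (μ[birkhoffSum T X n | m]) 2 μ =
      ‖geomSum (compression (lpMeas E ℝ m 2 μ) (koopman hT)) n hX2.toLp‖ := by
  rw [lpNorm_condExp (memLp_birkhoffSum hT hX2 n), ← geomSum_koopman_toLp hT hX2 n,
    starProjection_geomSum_apply (K := lpMeas E ℝ m 2 μ) (norm_koopman_apply hT)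
      (lpMeas_le_map_koopman hm.out hmT hT) n (toLp_mem_lpMeas hX2 hX)]

theorem lpNorm_condExp_birkhoffSum_le_add (hmT : m ≤ m.comap T) (hT : MeasurePreserving T μ μ)
    (hX : AEStronglyMeasurable[m] X μ) (hX2 : MemLp X 2 μ) (i k : ℕ) :
    lpNorm (μ[birkhoffSum T X i | m]) 2 μ ≤
      lpNorm (μ[birkhoffSum T X (i + k) | m]) 2 μ + lpNorm (μ[birkhoffSum T X k | m]) 2 μ := by
  simp only [lpNorm_condExp_birkhoffSum hmT hT hX hX2]
  exact norm_geomSum_apply_le_add (norm_compression_apply_le (norm_koopman_apply hT)) i k _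

theorem exists_condExp_comp_eq_zero_lpNorm_birkhoffSum_sub_le (hmT : m ≤ m.comap T)
    (hT : MeasurePreserving T μ μ) (hX : AEStronglyMeasurable[m] X μ) (hX2 : MemLp X 2 μ)
    {e : ℕ → ℝ} (h : DyadicControl (fun n => lpNorm (μ[birkhoffSum T X n | m]) 2 μ) e)
    (he : Tendsto e atTop (𝓝 0)) :
    ∃ d : Ω → E, StronglyMeasurable[m] d ∧ MemLp d 2 μ ∧ μ[d ∘ T | m] =ᵐ[μ] 0 ∧
      ∀ s, lpNorm (birkhoffSum T (X - d ∘ T) (2 ^ s)) 2 μ ≤ √2 ^ s * (8 * e s) := by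
  simp only [lpNorm_condExp_birkhoffSum hmT hT hX hX2] at h
  obtain ⟨_, ⟨⟨x, hx, rfl⟩, horth⟩, hle⟩ := exists_mem_innovationSpace_norm_geomSum_sub_le
    (K := lpMeas E ℝ m 2 μ) (norm_koopman_apply hT) (lpMeas_le_map_koopman hm.out hmT hT)
    (toLp_mem_lpMeas hX2 hX) h he
  obtain ⟨d, hd2, hd, rfl⟩ := exists_stronglyMeasurable_toLp_eq hx
  have hdT2 : MemLp (d ∘ T) 2 μ := hd2.comp_measurePreserving hT
  have hkoopman : koopman hT hd2.toLp = hdT2.toLp := koopman_toLp hT hd2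
  rw [ContinuousLinearMap.coe_coe, hkoopman] at horth hle
  refine ⟨d, hd, hd2, ?_, fun s => ?_⟩
  · have hproj := starProjection_lpMeas_toLp_ae_eq (m := m) hdT2
    rw [(Submodule.starProjection_apply_eq_zero_iff _).2 horth] at hproj
    exact hproj.symm.trans (Lp.coeFn_zero _ _ _)
  · have hs := hle s
    rwa [← MemLp.toLp_sub, geomSum_koopman_toLp, Lp.norm_toLp,
      toReal_eLpNorm (memLp_birkhoffSum hT (hX2.sub hdT2) _).aestronglyMeasurable] at hs

end CondExp

/-! ### Stationary martingale differences and measure preserving maps -/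

section Transfer

variable {Ω Ω' : Type*} {mΩ : MeasurableSpace Ω} {mΩ' : MeasurableSpace Ω'} {μ : Measure Ω}
  {ν : Measure Ω'} {φ : Ω → Ω'}

theorem partialSum_succ (X : ℤ → Ω → ℝ) (n : ℕ) :
    partialSum X (n + 1) = partialSum X n + X n :=
  funext fun _ => Finset.sum_range_succ _ _

theorem memLp_partialSum {X : ℤ → Ω → ℝ} {p : ENNReal} (hX : ∀ k, MemLp (X k) p μ) (n : ℕ) :
    MemLp (partialSum X n) p μ :=
  memLp_finsetSum _ fun i _ => hX i

theorem aestronglyMeasurable_comap_comp {E : Type*} [TopologicalSpace E] {g : Ω' → E}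
    (hg : AEStronglyMeasurable g ν) (hφ : Measure.QuasiMeasurePreserving φ μ ν) :
    AEStronglyMeasurable[mΩ'.comap φ] (g ∘ φ) μ :=
  ⟨hg.mk g ∘ φ, hg.stronglyMeasurable_mk.comp_measurable (comap_measurable φ),
    hφ.ae_eq_comp hg.ae_eq_mk⟩

theorem identDistrib_comp_of_measurePreserving {E : Type*} [MeasurableSpace E] {f : Ω' → E}
    (hφ : MeasurePreserving φ μ ν) (hf : AEMeasurable f ν) : IdentDistrib (f ∘ φ) f μ ν where
  aemeasurable_fst := hf.comp_quasiMeasurePreserving hφ.quasiMeasurePreserving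
  aemeasurable_snd := hf
  map_eq := by
    have hf' : AEMeasurable f (μ.map φ) := by rwa [hφ.map_eq]
    rw [← hf'.map_map_of_aemeasurable hφ.aemeasurable, hφ.map_eq]

theorem IsStationary.comp {E : Type*} [MeasurableSpace E] {Y : ℤ → Ω' → E}
    (h : IsStationary Y ν) (hφ : MeasurePreserving φ μ ν) :
    IsStationary (fun k => Y k ∘ φ) μ := fun m =>
  ((identDistrib_comp_of_measurePreserving hφ (h m).aemeasurable_fst).trans (h m)).trans
    (identDistrib_comp_of_measurePreserving hφ (h m).aemeasurable_snd).symm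

theorem LogApprox.comp {X D : ℤ → Ω' → ℝ} (h : LogApprox ν X D) (hφ : MeasurePreserving φ μ ν) :
    LogApprox μ (fun k => X k ∘ φ) fun k => D k ∘ φ :=
  hφ.quasiMeasurePreserving.ae h

theorem LogCondition.summable {F : MeasurableSpace Ω} {X : ℤ → Ω → ℝ} (h : LogCondition μ F X)
    (hX : ∀ k, MemLp (X k) 2 μ) :
    Summable (maxwellWoodroofeTerm fun k => lpNorm (μ[partialSum X k | F]) 2 μ) ∧
      Summable fun n : ℕ => Real.log n / n *
        tailSum (maxwellWoodroofeTerm fun k => lpNorm (μ[partialSum X k | F]) 2 μ) n ^ 2 := by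
  refine summable_of_tsum_Ici_mul_sq_lt_top (l := 1) (m := 2)
    (fun n => div_nonneg (Real.log_natCast_nonneg n) n.cast_nonneg)
    (maxwellWoodroofeTerm_nonneg fun _ => lpNorm_nonneg) one_le_two
    (div_pos (Real.log_pos (by norm_num)) (by norm_num)) ?_
  have hterm (n : Set.Ici 1) (k : Set.Ici (n : ℕ)) :
      ENNReal.ofReal (maxwellWoodroofeTerm (fun k => lpNorm (μ[partialSum X k | F]) 2 μ) k) =
        eLpNorm (μ[partialSum X k | F]) 2 μ / ((k : ℕ) : ENNReal) ^ (3 / 2 : ℝ) := by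
    have hk : 0 < (k : ℕ) := lt_of_lt_of_le n.2 k.2
    rw [maxwellWoodroofeTerm, ← ofReal_div_natCast_rpow hk,
      ofReal_lpNorm ((memLp_partialSum hX k).condExp one_le_two)]
  simpa only [hterm, LogCondition] using h

variable [IsFiniteMeasure μ] [IsFiniteMeasure ν]

theorem IsStationaryMartingaleDiff.of_condExp_eq_zero {ℱ : Filtration ℤ mΩ} {D : ℤ → Ω → ℝ}
    (hD : ∀ k, StronglyMeasurable[ℱ (k + 1)] (D k)) (hD2 : ∀ k, MemLp (D k) 2 μ)
    (hst : IsStationary D μ) (h0 : ∀ k, μ[D k | ℱ k] =ᵐ[μ] 0) :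
    IsStationaryMartingaleDiff μ ℱ D where
  adapted := hD
  memLp := hD2
  stationary := hst
  condExp_eq_zero := h0
  martingale := by
    refine martingale_of_condExp_sub_eq_zero_nat
      (fun n => Finset.stronglyMeasurable_fun_sum _ fun i hi => ?_)
      (fun n => (memLp_partialSum hD2 n).integrable one_le_two) fun n => ?_
    · have hin : ((i : ℤ) + 1) ≤ n := by exact_mod_cast Finset.mem_range.1 hi
      exact (hD i).mono (ℱ.mono hin)
    · rw [partialSum_succ, add_sub_cancel_left]
      exact h0 n

theorem IsStationaryMartingaleDiff.comp {ℱ : Filtration ℤ mΩ} {ℱ' : Filtration ℤ mΩ'}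
    {D : ℤ → Ω' → ℝ} (h : IsStationaryMartingaleDiff ν ℱ' D) (hφ : MeasurePreserving φ μ ν)
    (hℱ : ∀ k, ℱ k = (ℱ' k).comap φ) :
    IsStationaryMartingaleDiff μ ℱ fun k => D k ∘ φ := by
  refine .of_condExp_eq_zero (fun k => ?_) (fun k => (h.memLp k).comp_measurePreserving hφ)
    (h.stationary.comp hφ) fun k => ?_
  · rw [hℱ]
    exact (h.adapted k).comp_measurable (comap_measurable φ)
  · rw [hℱ]
    exact (condExp_comp_measurePreserving hφ (ℱ'.le k) ((h.memLp k).integrable one_le_two)).trans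
      (hφ.quasiMeasurePreserving.ae_eq_comp (h.condExp_eq_zero k))

theorem logCondition_comp_iff {X : ℤ → Ω' → ℝ} (hX : ∀ k, Integrable (X k) ν)
    (hφ : MeasurePreserving φ μ ν) {F : MeasurableSpace Ω'} (hF : F ≤ mΩ') :
    LogCondition μ (F.comap φ) (fun k => X k ∘ φ) ↔ LogCondition ν F X := by
  have hnorm (n : ℕ) : eLpNorm (μ[partialSum (fun k => X k ∘ φ) n | F.comap φ]) 2 μ =
      eLpNorm (ν[partialSum X n | F]) 2 ν := by
    have hint : Integrable (partialSum X n) ν := integrable_finsetSum _ fun i _ => hX i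
    exact (eLpNorm_congr_ae (condExp_comp_measurePreserving hφ hF hint)).trans
      (eLpNorm_comp_measurePreserving integrable_condExp.aestronglyMeasurable hφ)
  simp only [LogCondition, hnorm]

end Transfer

/-! ### Invertible measure preserving transformations -/

section Iterates

variable {Ω : Type*} {mΩ : MeasurableSpace Ω} {μ : Measure Ω} {T : Ω ≃ᵐ Ω}

theorem iter_zero (T : Ω ≃ᵐ Ω) : iter T 0 = id := by
  simp [iter]

theorem iter_add (T : Ω ≃ᵐ Ω) (k l : ℤ) : iter T (k + l) = iter T k ∘ iter T l := by
  funext ω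
  simp [iter, zpow_add]

theorem iter_natCast (T : Ω ≃ᵐ Ω) (n : ℕ) : iter T n = T^[n] := by
  induction n with
  | zero => exact iter_zero T
  | succ n ih => rw [Nat.cast_succ, iter_succ, ih, Function.iterate_succ']

theorem iter_neg_natCast (T : Ω ≃ᵐ Ω) (n : ℕ) : iter T (-n) = T.symm^[n] := by
  have hleft : T.symm^[n] ∘ T^[n] = id := (T.left_inv.iterate n).comp_eq_id
  rw [← Function.id_comp (iter T (-n)), ← hleft, Function.comp_assoc, ← iter_natCast T n,
    ← iter_add, add_neg_cancel, iter_zero, Function.comp_id]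

theorem measurePreserving_iter (hT : MeasurePreserving T μ μ) (k : ℤ) :
    MeasurePreserving (iter T k) μ μ := by
  obtain ⟨n, rfl | rfl⟩ := k.eq_nat_or_neg
  · rw [iter_natCast]
    exact hT.iterate n
  · rw [iter_neg_natCast]
    exact (hT.symm T).iterate n

theorem partialSum_comp_iter (T : Ω ≃ᵐ Ω) (Y : Ω → ℝ) (n : ℕ) :
    partialSum (fun k => Y ∘ iter T k) n = birkhoffSum T Y n := by
  funext ω
  simp [partialSum, birkhoffSum, iter_natCast]

theorem isStationary_comp_iter {E : Type*} [MeasurableSpace E] (hT : MeasurePreserving T μ μ)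
    {Y : Ω → E} (hY : AEMeasurable Y μ) : IsStationary (fun k => Y ∘ iter T k) μ := by
  intro m
  have hshift : (fun ω k => (Y ∘ iter T (k + m)) ω) =
      (fun ω k => (Y ∘ iter T k) ω) ∘ iter T m := by
    funext ω k
    simp [iter_add]
  rw [hshift]
  exact identDistrib_comp_of_measurePreserving (measurePreserving_iter hT m)
    (aemeasurable_pi_lambda _ fun k =>
      hY.comp_quasiMeasurePreserving (measurePreserving_iter hT k).quasiMeasurePreserving)

end Iterates

section InvertibleTransformation

variable {Ω : Type*} {F₀ mΩ : MeasurableSpace Ω} {μ : Measure Ω} [IsFiniteMeasure μ] {T : Ω ≃ᵐ Ω}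

theorem isStationaryMartingaleDiff_comp_iter (hT : MeasurePreserving T μ μ) (hF₀ : F₀ ≤ mΩ)
    (hF₀T : F₀ ≤ F₀.comap T) {d : Ω → ℝ} (hd : StronglyMeasurable[F₀] d) (hd2 : MemLp d 2 μ)
    (h0 : μ[d ∘ T | F₀] =ᵐ[μ] 0) :
    IsStationaryMartingaleDiff μ (shiftFiltration T F₀ hF₀ hF₀T)
      fun k => (d ∘ T) ∘ iter T k := by
  have hdT2 : MemLp (d ∘ T) 2 μ := hd2.comp_measurePreserving hT
  have hiter := measurePreserving_iter hT
  refine .of_condExp_eq_zero (fun k => ?_) (fun k => hdT2.comp_measurePreserving (hiter k))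
    (isStationary_comp_iter hT hdT2.aestronglyMeasurable.aemeasurable) fun k => ?_
  · rw [Function.comp_assoc, ← iter_succ]
    exact hd.comp_measurable (comap_measurable _)
  · exact (condExp_comp_measurePreserving (hiter k) hF₀ (hdT2.integrable one_le_two)).trans
      ((hiter k).quasiMeasurePreserving.ae_eq_comp h0)

theorem logApprox_comp_iter_of_summable (hT : MeasurePreserving T μ μ) {X₀ D₀ : Ω → ℝ}
    (hX2 : MemLp X₀ 2 μ) (hD2 : MemLp D₀ 2 μ)
    (hs : Summable fun j => ∫ ω, dyadicSq T (X₀ - D₀) j ω ∂μ) :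
    LogApprox μ (fun k => X₀ ∘ iter T k) fun k => D₀ ∘ iter T k := by
  filter_upwards [ae_isLittleO_birkhoffSum hT (hX2.sub hD2) hs] with ω hω
  simpa only [partialSum_comp_iter, birkhoffSum_sub] using hω.tendsto_div_nhds_zero

theorem exists_isStationaryMartingaleDiff_logApprox_of_measurePreserving
    (hT : MeasurePreserving T μ μ) (hF₀ : F₀ ≤ mΩ) (hF₀T : F₀ ≤ F₀.comap T) {X₀ : Ω → ℝ}
    (hX : AEStronglyMeasurable[F₀] X₀ μ) (hX2 : MemLp X₀ 2 μ)
    (hlog : LogCondition μ F₀ fun k => X₀ ∘ iter T k) :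
    ∃ D₀ : Ω → ℝ, IsStationaryMartingaleDiff μ (shiftFiltration T F₀ hF₀ hF₀T)
      (fun k => D₀ ∘ iter T k) ∧
      LogApprox μ (fun k => X₀ ∘ iter T k) fun k => D₀ ∘ iter T k := by
  have : Fact (F₀ ≤ mΩ) := ⟨hF₀⟩
  obtain ⟨hw, hlogw⟩ := hlog.summable fun k =>
    hX2.comp_measurePreserving (measurePreserving_iter hT k)
  simp only [partialSum_comp_iter] at hw hlogw
  have hcontrol := dyadicControl_tailSum (fun _ => lpNorm_nonneg)
    (lpNorm_condExp_birkhoffSum_le_add hF₀T hT hX hX2) hw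
  obtain ⟨d, hd, hd2, hd0, hle⟩ := exists_condExp_comp_eq_zero_lpNorm_birkhoffSum_sub_le hF₀T hT
    hX hX2 hcontrol <| by
      simpa only [mul_zero] using (tendsto_tailSum_two_pow _).const_mul 32
  have hdT2 : MemLp (d ∘ T) 2 μ := hd2.comp_measurePreserving hT
  refine ⟨d ∘ T, isStationaryMartingaleDiff_comp_iter hT hF₀ hF₀T hd hd2 hd0,
    logApprox_comp_iter_of_summable hT hX2 hdT2
      (summable_integral_dyadicSq hT (hX2.sub hdT2) hle ?_)⟩
  have hsum := summable_mul_tailSum_two_pow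
    (maxwellWoodroofeTerm_nonneg fun _ => lpNorm_nonneg) hw hlogw
  refine (hsum.mul_left ((8 * 32) ^ 2)).congr fun j => ?_
  ring

end InvertibleTransformation

/-! ### The shift on path space -/

section PathSpace

/-- The shift of two-sided sequences. -/
def pathShift (S : Type*) [MeasurableSpace S] : (ℤ → S) ≃ᵐ (ℤ → S) where
  toFun y k := y (k + 1)
  invFun y k := y (k - 1)
  left_inv y := by funext k; simp
  right_inv y := by funext k; simp
  measurable_toFun := measurable_pi_lambda _ fun k => measurable_pi_apply _
  measurable_invFun := measurable_pi_lambda _ fun k => measurable_pi_apply _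

/-- The filtration of the coordinate process on two-sided sequences. -/
abbrev pathPast (S : Type*) [MeasurableSpace S] :
    Filtration ℤ (MeasurableSpace.pi : MeasurableSpace (ℤ → S)) :=
  pastFiltration (fun k y => y k) measurable_pi_apply

variable {Ω S : Type*} {mΩ : MeasurableSpace Ω} [mS : MeasurableSpace S]

theorem iter_pathShift (k : ℤ) (y : ℤ → S) (j : ℤ) : iter (pathShift S) k y j = y (j + k) := by
  induction k using Int.induction_on generalizing j with
  | zero => simp [iter_zero]
  | succ n ih =>
    rw [iter_succ]
    exact (ih (j + 1)).trans (by ring_nf)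
  | pred n ih =>
    have hsucc : iter (pathShift S) (-n) = pathShift S ∘ iter (pathShift S) (-n - 1) := by
      rw [← iter_succ, sub_add_cancel]
    have hj : iter (pathShift S) (-n - 1) y (j - 1 + 1) = y (j - 1 + -n) := by
      rw [← ih (j - 1), hsucc]
      rfl
    rw [sub_add_cancel] at hj
    rw [hj]
    ring_nf

theorem comap_iter_pathPast (k l : ℤ) :
    (pathPast S k).comap (iter (pathShift S) l) = pathPast S (k + l) := by
  have heval (i : ℤ) : (fun y : ℤ → S => y i) ∘ iter (pathShift S) l = fun y => y (i + l) :=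
    funext fun y => iter_pathShift l y i
  change (⨆ i : Set.Iic k, mS.comap fun y : ℤ → S => y i).comap _ =
    ⨆ i : Set.Iic (k + l), mS.comap fun y : ℤ → S => y i
  simp only [MeasurableSpace.comap_iSup, MeasurableSpace.comap_comp, heval]
  exact ((Equiv.addRight l).subtypeEquiv fun i => by simp).iSup_congr fun i => rfl

theorem pathPast_le_comap : pathPast S 0 ≤ (pathPast S 0).comap (pathShift S) := by
  have h : (pathPast S 0).comap (iter (pathShift S) 1) = pathPast S (0 + 1) :=
    comap_iter_pathPast 0 1
  have hone : iter (pathShift S) 1 = pathShift S := by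
    simpa [iter_zero] using iter_succ (pathShift S) 0
  rw [← hone, h]
  exact (pathPast S).mono zero_le_one

theorem shiftFiltration_pathShift :
    shiftFiltration (pathShift S) (pathPast S 0) ((pathPast S).le 0) pathPast_le_comap =
      pathPast S :=
  Filtration.ext <| funext fun k => (comap_iter_pathPast 0 k).trans (by rw [zero_add])

theorem pastFiltration_eq_comap {ξ : ℤ → Ω → S} (hξ : ∀ k, Measurable (ξ k)) (k : ℤ) :
    pastFiltration ξ hξ k = (pathPast S k).comap fun ω j => ξ j ω := by
  change (⨆ i : Set.Iic k, mS.comap (ξ i)) =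
    (⨆ i : Set.Iic k, mS.comap fun y : ℤ → S => y i).comap _
  simp only [MeasurableSpace.comap_iSup, MeasurableSpace.comap_comp]
  rfl

variable {μ : Measure Ω} {ξ : ℤ → Ω → S}

theorem measurePreserving_pathShift (hξ : IsStationary ξ μ) :
    MeasurePreserving (pathShift S) (μ.map fun ω j => ξ j ω) (μ.map fun ω j => ξ j ω) := by
  refine ⟨(pathShift S).measurable, ?_⟩
  rw [(pathShift S).measurable.aemeasurable.map_map_of_aemeasurable (hξ 1).aemeasurable_snd]
  exact (hξ 1).map_eq

theorem exists_isStationaryMartingaleDiff_logApprox_of_isStationary [IsFiniteMeasure μ]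
    (hξ : ∀ k, Measurable (ξ k)) (hst : IsStationary ξ μ) {f : S → ℝ}
    (hf2 : MemLp f 2 (μ.map (ξ 0)))
    (hlog : LogCondition μ (pastFiltration ξ hξ 0) fun k => f ∘ ξ k) :
    ∃ D : ℤ → Ω → ℝ, IsStationaryMartingaleDiff μ (pastFiltration ξ hξ) D ∧
      LogApprox μ (fun k => f ∘ ξ k) D := by
  have hφ : MeasurePreserving (fun ω j => ξ j ω) μ (μ.map fun ω j => ξ j ω) :=
    (measurable_pi_lambda _ hξ).measurePreserving μ
  have hT := measurePreserving_pathShift hst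
  have heval : MeasurePreserving (fun y : ℤ → S => y 0) (μ.map fun ω j => ξ j ω) (μ.map (ξ 0)) :=
    ⟨measurable_pi_apply _, Measure.map_map (measurable_pi_apply _) hφ.measurable⟩
  have hX2 := hf2.comp_measurePreserving heval
  have hX : AEStronglyMeasurable[pathPast S 0] (f ∘ fun y : ℤ → S => y 0)
      (μ.map fun ω j => ξ j ω) :=
    (aestronglyMeasurable_comap_comp hf2.aestronglyMeasurable heval.quasiMeasurePreserving).mono
      (le_iSup (fun i : Set.Iic (0 : ℤ) => mS.comap fun y : ℤ → S => y i) ⟨0, Set.self_mem_Iic⟩)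
  have hpath : (fun k => ((f ∘ fun y : ℤ → S => y 0) ∘ iter (pathShift S) k) ∘ fun ω j => ξ j ω) =
      fun k => f ∘ ξ k := by
    funext k ω
    simp [iter_pathShift]
  rw [pastFiltration_eq_comap, ← hpath, logCondition_comp_iff (fun k =>
    (hX2.comp_measurePreserving (measurePreserving_iter hT k)).integrable one_le_two) hφ
    ((pathPast S).le 0)] at hlog
  obtain ⟨D₀, hD, hDlog⟩ := exists_isStationaryMartingaleDiff_logApprox_of_measurePreserving hT
    ((pathPast S).le 0) pathPast_le_comap hX hX2 hlog
  rw [shiftFiltration_pathShift] at hD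
  exact ⟨_, hD.comp hφ (pastFiltration_eq_comap hξ), hpath ▸ hDlog.comp hφ⟩

end PathSpace

end MartApprox

theorem mainTheorem4_general {Ω : Type*} [mΩ : MeasurableSpace Ω] (μ : Measure Ω)
    [IsFiniteMeasure μ] :
    (∀ T : Ω ≃ᵐ Ω, MeasurePreserving T μ μ →
      ∀ (F₀ : MeasurableSpace Ω) (hF₀ : F₀ ≤ mΩ) (hT : F₀ ≤ F₀.comap T) (X₀ : Ω → ℝ),
      AEStronglyMeasurable[F₀] X₀ μ → MemLp X₀ 2 μ →
      MartApprox.LogCondition μ F₀ (fun k => X₀ ∘ MartApprox.iter T k) →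
      ∃ D₀ : Ω → ℝ,
        MartApprox.IsStationaryMartingaleDiff μ (MartApprox.shiftFiltration T F₀ hF₀ hT)
          (fun k => D₀ ∘ MartApprox.iter T k) ∧
        MartApprox.LogApprox μ (fun k => X₀ ∘ MartApprox.iter T k)
          (fun k => D₀ ∘ MartApprox.iter T k)) ∧
    (∀ {S : Type*} [MeasurableSpace S] (ξ : ℤ → Ω → S) (hξ : ∀ k, Measurable (ξ k))
        (f : S → ℝ),
      MartApprox.IsStationary ξ μ → MemLp f 2 (μ.map (ξ 0)) →
      MartApprox.LogCondition μ (MartApprox.pastFiltration ξ hξ 0) (fun k => f ∘ ξ k) →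
      ∃ D : ℤ → Ω → ℝ,
        MartApprox.IsStationaryMartingaleDiff μ (MartApprox.pastFiltration ξ hξ) D ∧
        MartApprox.LogApprox μ (fun k => f ∘ ξ k) D) :=
  ⟨fun _ hT _ hF₀ hF₀T _ hX hX2 hlog =>
    MartApprox.exists_isStationaryMartingaleDiff_logApprox_of_measurePreserving
      hT hF₀ hF₀T hX hX2 hlog,
  fun _ hξ _ hst hf2 hlog =>
    MartApprox.exists_isStationaryMartingaleDiff_logApprox_of_isStationary hξ hst hf2 hlog⟩

theorem mainTheorem4 {Ω : Type*} [mΩ : MeasurableSpace Ω] (μ : Measure Ω)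
    [IsProbabilityMeasure μ] :
    -- measure preserving transformations: `X_k = X₀ ∘ T ^ k`, `ℱ_k = T ^ {-k}(ℱ₀)`
    (∀ T : Ω ≃ᵐ Ω, MeasurePreserving T μ μ →
      ∀ (F₀ : MeasurableSpace Ω) (hF₀ : F₀ ≤ mΩ) (hT : F₀ ≤ F₀.comap T) (X₀ : Ω → ℝ),
      Measurable[F₀] X₀ → MemLp X₀ 2 μ → ∫ ω, X₀ ω ∂μ = 0 →
      MartApprox.LogCondition μ F₀ (fun k => X₀ ∘ MartApprox.iter T k) →
      ∃ D₀ : Ω → ℝ,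
        MartApprox.IsStationaryMartingaleDiff μ (MartApprox.shiftFiltration T F₀ hF₀ hT)
          (fun k => D₀ ∘ MartApprox.iter T k) ∧
        MartApprox.LogApprox μ (fun k => X₀ ∘ MartApprox.iter T k)
          (fun k => D₀ ∘ MartApprox.iter T k)) ∧
    -- functions of a stationary Markov chain: `X_k = f(ξ_k)`, `ℱ_k = σ(ξ_i, i ≤ k)`
    (∀ {S : Type*} [MeasurableSpace S] (ξ : ℤ → Ω → S) (hξ : ∀ k, Measurable (ξ k))
        (f : S → ℝ),
      MartApprox.IsStationaryMarkovChain ξ hξ μ → Measurable f → MemLp f 2 (μ.map (ξ 0)) →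
      ∫ s, f s ∂(μ.map (ξ 0)) = 0 →
      MartApprox.LogCondition μ (MartApprox.pastFiltration ξ hξ 0) (fun k => f ∘ ξ k) →
      ∃ D : ℤ → Ω → ℝ,
        MartApprox.IsStationaryMartingaleDiff μ (MartApprox.pastFiltration ξ hξ) D ∧
        MartApprox.LogApprox μ (fun k => f ∘ ξ k) D) := by
  obtain ⟨hShift, hChain⟩ := mainTheorem4_general μ
  exact ⟨fun T hT F₀ hF₀ hF₀T X₀ hX hX2 _ hlog =>
      hShift T hT F₀ hF₀ hF₀T X₀ hX.stronglyMeasurable.aestronglyMeasurable hX2 hlog,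
    fun ξ hξ f hst _ hf2 _ hlog => hChain ξ hξ f hst.1 hf2 hlog⟩
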